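/- **Setting.** Let $S$ be a $C^*$-algebra, $\otimes$ the minimal (spatial) $C^*$-tensor product and $M(\cdot)$ the multiplier algebra. $S$ is a *Hopf $C^*$-algebra* if it carries a non-degenerate $*$-homomorphism $\delta:S\to M(S\otimes S)$ with $(\delta\otimes\mathrm{id})\delta=(\mathrm{id}\otimes\delta)\delta$ and $\delta(S)(1\otimes S),\ \delta(S)(S\otimes 1)\subseteq S\otimes S$; it is *saturated* if the linear spans of $\delta(S)(1\otimes S)$ and of $\delta(S)(S\otimes 1)$ are dense in $S\otimes S$. The dual $S^*$ is a Banach algebra under $fg=(f\otimes g)\circ\delta$ (where $f\otimes g$ is extended to $M(S\otimes S)$ by strict continuity). A *left* (*right*, *2-sided*) *Hopf ideal* is a non-zero norm-closed left (right, 2-sided) ideal $A$ of $S^*$ that is $S$-invariant, i.e. $f(\,\cdot\, s)\in A$ and $f(s\,\cdot\,)\in A$ for all $f\in A$, $s\in S$. Let $A_S^l$, $A_S^r$, $A_S$ be the intersections of all left, right, 2-sided Hopf ideals. For a left ideal $A$ of $S^*$ let $M_l(A)$ be the set of bounded operators $l$ on $A$ with $l(ab)=l(a)b$; for a right ideal $A$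 let $M_r(A)$ be the set of bounded operators $r$ on $A$ with $r(ab)=a\,r(b)$; for a 2-sided ideal $A$ let $M(A)$ be the set of pairs $(l,r)$ of bounded operators on $A$ with $l(ab)=l(a)b$, $r(ab)=a\,r(b)$ and $a\,l(b)=r(a)\,b$ (always for all $a,b\in A$). A saturated Hopf $C^*$-algebra $S$ is called - *left (right, 2-sided) $H_1$-coamenable* if $A_S^l$ ($A_S^r$, $A_S$) is non-zero and has a norm-bounded left (right, 2-sided) approximate identity; - *left (right, 2-sided) $H_2$-coamenable* if $S^*$ is unital and every left (right, 2-sided) Hopf ideal of $S^*$ separates the points of $S$; - *left (right, 2-sided) $H_3$-coamenable* if the canonical map $h\mapsto(a\mapsto ha)$ from $S^*$ to $M_l(A_S^l)$ (respectively $h\mapsto(a\mapsto ah)$ from $S^*$ to $M_r(A_S^r)$, respectively $h\mapsto(a\mapsto ha,\ a\mapsto ah)$ from $S^*$ to $M(A_S)$) is surjective. **Theorem 2.8.** Let $S$ be a saturated Hopf $C^*$-algebra. (a) If $S$ is left (respectively right, 2-sided) $H_1$-coamenable, then $S$ is left (respectively right, 2-sided) $H_2$-coamenable. (b) If $S$ is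 2-sided $H_2$-coamenable, then $S$ is 2-sided $H_3$-coamenable. Moreover the canonical map $S^*\to M(A_S)$ is then injective whenever $A_S\neq 0$, so that $S^*\cong M(A_S)$ canonically. (c) If $S$ is left (respectively right) $H_1$-coamenable, then $S$ is left (respectively right) $H_3$-coamenable, and the canonical map $S^*\to M_l(A_S^l)$ (respectively $S^*\to M_r(A_S^r)$) is also injective, so that $S^*\cong M_l(A_S^l)$ (respectively $S^*\cong M_r(A_S^r)$) canonically. -/

import Mathlib

open scoped TensorProduct InnerProductSpace MultiplierAlgebra
open Filter Topology

noncomputable section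

namespace HopfCStar

section HilbertTensor

variable {H K : Type*} [NormedAddCommGroup H] [InnerProductSpace ℂ H]
  [NormedAddCommGroup K] [InnerProductSpace ℂ K]

/-- The Hilbert space tensor product: the completion of the algebraic tensor product with inner
product `⟪ξ ⊗ η, ξ' ⊗ η'⟫ = ⟪ξ, ξ'⟫ ⟪η, η'⟫`. -/
def HTensor (H K : Type*) [NormedAddCommGroup H] [InnerProductSpace ℂ H]
    [NormedAddCommGroup K] [InnerProductSpace ℂ K] : Type _ :=
  UniformSpace.Completion (H ⊗[ℂ] K)

instance : NormedAddCommGroup (HTensor H K) :=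
  inferInstanceAs (NormedAddCommGroup (UniformSpace.Completion (H ⊗[ℂ] K)))

instance : InnerProductSpace ℂ (HTensor H K) :=
  inferInstanceAs (InnerProductSpace ℂ (UniformSpace.Completion (H ⊗[ℂ] K)))

instance : CompleteSpace (HTensor H K) :=
  inferInstanceAs (CompleteSpace (UniformSpace.Completion (H ⊗[ℂ] K)))

/-- The canonical isometric embedding of the algebraic tensor product. -/
def hcoe : H ⊗[ℂ] K →ₗᵢ[ℂ] HTensor H K :=
  (UniformSpace.Completion.toComplₗᵢ : H ⊗[ℂ] K →ₗᵢ[ℂ] UniformSpace.Completion (H ⊗[ℂ] K))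

theorem hcoe_dense : DenseRange (hcoe : H ⊗[ℂ] K → HTensor H K) :=
  UniformSpace.Completion.denseRange_coe (α := H ⊗[ℂ] K)

/-- The vector `ξ ⊗ η` of the Hilbert space tensor product. -/
def htmul (ξ : H) (η : K) : HTensor H K := hcoe (ξ ⊗ₜ[ℂ] η)

theorem htmul_span_dense :
    Dense (Submodule.span ℂ {v : HTensor H K | ∃ ξ η, v = htmul ξ η} : Set (HTensor H K)) := by
  refine hcoe_dense.mono ?_
  rintro _ ⟨z, rfl⟩
  induction z using TensorProduct.induction_on with
  | zero => simp
  | tmul ξ η => exact Submodule.subset_span ⟨ξ, η, rfl⟩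
  | add x y hx hy =>
    rw [map_add]
    exact Submodule.add_mem _ hx hy

theorem clm_ext_htmul {E : Type*} [NormedAddCommGroup E] [NormedSpace ℂ E]
    {u v : HTensor H K →L[ℂ] E} (h : ∀ ξ η, u (htmul ξ η) = v (htmul ξ η)) : u = v := by
  refine ContinuousLinearMap.ext_on htmul_span_dense ?_
  rintro _ ⟨ξ, η, rfl⟩
  exact h ξ η

/-- The operator `a ⊗ b` on the Hilbert space tensor product. -/
def opTensor (a : H →L[ℂ] H) (b : K →L[ℂ] K) : HTensor H K →L[ℂ] HTensor H K :=
  (hcoe.toContinuousLinearMap ∘L TensorProduct.mapL a b).extend hcoe.toContinuousLinearMap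

theorem opTensor_htmul (a : H →L[ℂ] H) (b : K →L[ℂ] K) (ξ : H) (η : K) :
    opTensor a b (htmul ξ η) = htmul (a ξ) (b η) :=
  ContinuousLinearMap.extend_eq (hcoe.toContinuousLinearMap ∘L TensorProduct.mapL a b)
    (e := hcoe.toContinuousLinearMap) hcoe_dense hcoe.isometry.isUniformInducing (ξ ⊗ₜ η)

theorem htmul_add_left (ξ ξ' : H) (η : K) : htmul (ξ + ξ') η = htmul ξ η + htmul ξ' η := by
  rw [htmul, TensorProduct.add_tmul, map_add]; rfl

theorem htmul_add_right (ξ : H) (η η' : K) : htmul ξ (η + η') = htmul ξ η + htmul ξ η' := by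
  rw [htmul, TensorProduct.tmul_add, map_add]; rfl

theorem htmul_smul_left (c : ℂ) (ξ : H) (η : K) : htmul (c • ξ) η = c • htmul ξ η := by
  rw [htmul, ← TensorProduct.smul_tmul', map_smul]; rfl

theorem htmul_smul_right (c : ℂ) (ξ : H) (η : K) : htmul ξ (c • η) = c • htmul ξ η := by
  rw [htmul, TensorProduct.tmul_smul, map_smul]; rfl

theorem inner_htmul (ξ ξ' : H) (η η' : K) :
    ⟪htmul ξ η, htmul ξ' η'⟫_ℂ = ⟪ξ, ξ'⟫_ℂ * ⟪η, η'⟫_ℂ := by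
  simp [htmul, LinearIsometry.inner_map_map]

theorem norm_htmul (ξ : H) (η : K) : ‖htmul ξ η‖ = ‖ξ‖ * ‖η‖ := by
  simp [htmul]

theorem opTensor_mul (a a' : H →L[ℂ] H) (b b' : K →L[ℂ] K) :
    opTensor a b * opTensor a' b' = opTensor (a * a') (b * b') := by
  apply clm_ext_htmul
  intro ξ η
  simp [opTensor_htmul]

theorem opTensor_add_left (a a' : H →L[ℂ] H) (b : K →L[ℂ] K) :
    opTensor (a + a') b = opTensor a b + opTensor a' b := by
  apply clm_ext_htmul
  intro ξ η
  simp [opTensor_htmul, htmul_add_left]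

theorem opTensor_add_right (a : H →L[ℂ] H) (b b' : K →L[ℂ] K) :
    opTensor a (b + b') = opTensor a b + opTensor a b' := by
  apply clm_ext_htmul
  intro ξ η
  simp [opTensor_htmul, htmul_add_right]

theorem opTensor_smul_left (c : ℂ) (a : H →L[ℂ] H) (b : K →L[ℂ] K) :
    opTensor (c • a) b = c • opTensor a b := by
  apply clm_ext_htmul
  intro ξ η
  simp [opTensor_htmul, htmul_smul_left]

theorem opTensor_smul_right (c : ℂ) (a : H →L[ℂ] H) (b : K →L[ℂ] K) :
    opTensor a (c • b) = c • opTensor a b := by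
  apply clm_ext_htmul
  intro ξ η
  simp [opTensor_htmul, htmul_smul_right]

theorem opTensor_star [CompleteSpace H] [CompleteSpace K] (a : H →L[ℂ] H) (b : K →L[ℂ] K) :
    star (opTensor a b) = opTensor (star a) (star b) := by
  rw [ContinuousLinearMap.star_eq_adjoint, eq_comm, ContinuousLinearMap.eq_adjoint_iff]
  intro x y
  have key : (innerSL ℂ y ∘L opTensor (star a) (star b)) =
      (innerSL ℂ (opTensor a b y)) := by
    apply clm_ext_htmul
    intro ξ η
    have : (innerSL ℂ (opTensor (star a) (star b) (htmul ξ η))) =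
        (innerSL ℂ (htmul ξ η)) ∘L opTensor a b := by
      apply clm_ext_htmul
      intro ξ' η'
      simp [opTensor_htmul, inner_htmul, ContinuousLinearMap.star_eq_adjoint,
        ContinuousLinearMap.adjoint_inner_left]
    have h2 := congrArg (starRingEnd ℂ) (DFunLike.congr_fun this y)
    simpa [inner_conj_symm] using h2
  have h3 := congrArg (starRingEnd ℂ) (DFunLike.congr_fun key x)
  simpa [inner_conj_symm] using h3

end HilbertTensor

section MinimalTensor

/-- A faithful (i.e. injective) `*`-representation of a C⋆-algebra on a Hilbert space. -/
structure FaithfulRep (A H : Type*) [NonUnitalCStarAlgebra A] [NormedAddCommGroup H]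
    [InnerProductSpace ℂ H] [CompleteSpace H] where
  /-- The underlying `*`-homomorphism. -/
  toHom : A →⋆ₙₐ[ℂ] (H →L[ℂ] H)
  injective : Function.Injective toHom

variable {A B H K : Type*} [NonUnitalCStarAlgebra A] [NonUnitalCStarAlgebra B]
  [NormedAddCommGroup H] [InnerProductSpace ℂ H] [CompleteSpace H]
  [NormedAddCommGroup K] [InnerProductSpace ℂ K] [CompleteSpace K]

theorem FaithfulRep.norm_map (π : FaithfulRep A H) (a : A) : ‖π.toHom a‖ = ‖a‖ :=
  NonUnitalStarAlgHom.norm_map π.toHom π.injective a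

/-- The spatial (minimal) C⋆-tensor product `A ⊗ B` of C⋆-algebras `A ⊆ B(H)` and `B ⊆ B(K)`, as
the C⋆-subalgebra of `B(H ⊗ K)` generated by all operators `a ⊗ b`. -/
def minTensor (π : FaithfulRep A H) (ρ : FaithfulRep B K) :
    NonUnitalStarSubalgebra ℂ (HTensor H K →L[ℂ] HTensor H K) :=
  (NonUnitalStarAlgebra.adjoin ℂ
    {x | ∃ a b, x = opTensor (π.toHom a) (ρ.toHom b)}).topologicalClosure

theorem isClosed_minTensor (π : FaithfulRep A H) (ρ : FaithfulRep B K) :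
    IsClosed (minTensor π ρ : Set (HTensor H K →L[ℂ] HTensor H K)) :=
  NonUnitalStarSubalgebra.isClosed_topologicalClosure _

/-- `A ⊗ B` as a type. -/
def MinTensor (π : FaithfulRep A H) (ρ : FaithfulRep B K) : Type _ := ↥(minTensor π ρ)

variable (π : FaithfulRep A H) (ρ : FaithfulRep B K)

instance : NonUnitalCStarAlgebra (MinTensor π ρ) :=
  NonUnitalStarSubalgebra.nonUnitalCStarAlgebra (minTensor π ρ)
    (h_closed := isClosed_minTensor π ρ)

/-- The tautological faithful representation of `A ⊗ B` on `H ⊗ K`. -/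
def FaithfulRep.tensor : FaithfulRep (MinTensor π ρ) (HTensor H K) where
  toHom := NonUnitalStarSubalgebraClass.subtype (minTensor π ρ)
  injective := Subtype.val_injective

/-- The elementary tensor `a ⊗ b`. -/
def tmul (a : A) (b : B) : MinTensor π ρ :=
  ⟨opTensor (π.toHom a) (ρ.toHom b), NonUnitalStarSubalgebra.le_topologicalClosure _
    (NonUnitalStarAlgebra.subset_adjoin ℂ _ ⟨a, b, rfl⟩)⟩

theorem tensor_tmul (a : A) (b : B) :
    (π.tensor ρ).toHom (tmul π ρ a b) = opTensor (π.toHom a) (ρ.toHom b) := rfl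

theorem tmul_mul (a a' : A) (b b' : B) :
    tmul π ρ a b * tmul π ρ a' b' = tmul π ρ (a * a') (b * b') :=
  (π.tensor ρ).injective (by simp only [tensor_tmul, map_mul, opTensor_mul])

theorem tmul_star (a : A) (b : B) :
    star (tmul π ρ a b) = tmul π ρ (star a) (star b) :=
  (π.tensor ρ).injective (by simp only [tensor_tmul, map_star, opTensor_star])

/-- The canonical map from the algebraic tensor product to `A ⊗ B`. -/
def ofAlg : A ⊗[ℂ] B →ₗ[ℂ] MinTensor π ρ :=
  TensorProduct.lift (LinearMap.mk₂ ℂ (tmul π ρ)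
    (fun a a' b => (π.tensor ρ).injective
      (by simp only [tensor_tmul, map_add, opTensor_add_left]))
    (fun c a b => (π.tensor ρ).injective
      (by simp only [tensor_tmul, map_smul, opTensor_smul_left]))
    (fun a b b' => (π.tensor ρ).injective
      (by simp only [tensor_tmul, map_add, opTensor_add_right]))
    (fun c a b => (π.tensor ρ).injective
      (by simp only [tensor_tmul, map_smul, opTensor_smul_right])))

theorem ofAlg_tmul (a : A) (b : B) : ofAlg π ρ (a ⊗ₜ[ℂ] b) = tmul π ρ a b := rfl

theorem ofAlg_mul (z w : A ⊗[ℂ] B) : ofAlg π ρ (z * w) = ofAlg π ρ z * ofAlg π ρ w := by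
  induction z using TensorProduct.induction_on with
  | zero => simp only [zero_mul, map_zero]
  | add u v hu hv => simp only [add_mul, map_add, hu, hv]
  | tmul a b =>
    induction w using TensorProduct.induction_on with
    | zero => simp only [mul_zero, map_zero]
    | add u v hu hv => simp only [mul_add, map_add, hu, hv]
    | tmul c d =>
      simp only [Algebra.TensorProduct.tmul_mul_tmul, ofAlg_tmul, tmul_mul]

theorem ofAlg_star (z : A ⊗[ℂ] B) : ∃ w, ofAlg π ρ w = star (ofAlg π ρ z) := by
  induction z using TensorProduct.induction_on with
  | zero => exact ⟨0, by simp only [map_zero, star_zero]⟩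
  | add u v hu hv =>
    obtain ⟨u', hu⟩ := hu
    obtain ⟨v', hv⟩ := hv
    exact ⟨u' + v', by simp only [map_add, star_add, hu, hv]⟩
  | tmul a b => exact ⟨star a ⊗ₜ star b, by simp only [ofAlg_tmul, tmul_star]⟩

theorem ofAlg_dense : DenseRange (ofAlg π ρ) := by
  have hspan : ∀ x ∈ NonUnitalStarAlgebra.adjoin ℂ
      {x | ∃ a b, x = opTensor (π.toHom a) (ρ.toHom b)},
      ∃ z : A ⊗[ℂ] B, (π.tensor ρ).toHom (ofAlg π ρ z) = x := by
    intro x hx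
    induction hx using NonUnitalStarAlgebra.adjoin_induction with
    | mem x hx =>
      obtain ⟨a, b, rfl⟩ := hx
      exact ⟨a ⊗ₜ b, rfl⟩
    | add x y _ _ hx hy =>
      obtain ⟨z, rfl⟩ := hx
      obtain ⟨w, rfl⟩ := hy
      exact ⟨z + w, by simp only [map_add]⟩
    | zero => exact ⟨0, by simp only [map_zero]⟩
    | mul x y _ _ hx hy =>
      obtain ⟨z, rfl⟩ := hx
      obtain ⟨w, rfl⟩ := hy
      exact ⟨z * w, by simp only [ofAlg_mul, map_mul]⟩
    | smul r x _ hx =>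
      obtain ⟨z, rfl⟩ := hx
      exact ⟨r • z, by simp only [map_smul]⟩
    | star x _ hx =>
      obtain ⟨z, rfl⟩ := hx
      obtain ⟨w, hw⟩ := ofAlg_star π ρ z
      exact ⟨w, by simp only [hw, map_star]⟩
  intro x
  refine Metric.mem_closure_iff.2 fun ε hε => ?_
  have hx : (π.tensor ρ).toHom x ∈ closure (NonUnitalStarAlgebra.adjoin ℂ
      {x | ∃ a b, x = opTensor (π.toHom a) (ρ.toHom b)} :
        Set (HTensor H K →L[ℂ] HTensor H K)) := x.2
  obtain ⟨y, hy, hxy⟩ := Metric.mem_closure_iff.1 hx ε hε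
  obtain ⟨z, rfl⟩ := hspan y hy
  exact ⟨_, ⟨z, rfl⟩, hxy⟩

theorem clm_ext_tmul {E : Type*} [NormedAddCommGroup E] [NormedSpace ℂ E]
    {u v : MinTensor π ρ →L[ℂ] E} (h : ∀ a b, u (tmul π ρ a b) = v (tmul π ρ a b)) : u = v := by
  refine DFunLike.coe_injective ((ofAlg_dense π ρ).equalizer u.continuous v.continuous ?_)
  funext z
  induction z using TensorProduct.induction_on with
  | zero => simp only [Function.comp_apply, map_zero]
  | add x y hx hy =>
    simp only [Function.comp_apply, map_add] at hx hy ⊢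
    rw [hx, hy]
  | tmul a b => exact h a b

end MinimalTensor

section Functionals

variable {A B H K : Type*} [NonUnitalCStarAlgebra A] [NonUnitalCStarAlgebra B]
  [NormedAddCommGroup H] [InnerProductSpace ℂ H] [CompleteSpace H]
  [NormedAddCommGroup K] [InnerProductSpace ℂ K] [CompleteSpace K]
  (π : FaithfulRep A H) (ρ : FaithfulRep B K)

/-- The functional `f ⊗ g` on the algebraic tensor product. -/
def algFunctional (f : A →L[ℂ] ℂ) (g : B →L[ℂ] ℂ) : A ⊗[ℂ] B →ₗ[ℂ] ℂ :=
  TensorProduct.lift ((LinearMap.mul ℂ ℂ).compl₁₂ f.toLinearMap g.toLinearMap)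

theorem algFunctional_tmul (f : A →L[ℂ] ℂ) (g : B →L[ℂ] ℂ) (a : A) (b : B) :
    algFunctional f g (a ⊗ₜ b) = f a * g b := rfl

theorem norm_le_of_inner {E : Type*} [NormedAddCommGroup E] [InnerProductSpace ℂ E] {v : E}
    {C : ℝ} (hC : 0 ≤ C) (h : ∀ w : E, ‖⟪w, v⟫_ℂ‖ ≤ C * ‖w‖) : ‖v‖ ≤ C := by
  have := h v
  rw [inner_self_eq_norm_sq_to_K] at this
  rcases eq_or_ne ‖v‖ 0 with h0 | h0
  · rw [h0]; exact hC
  · have hpos : 0 < ‖v‖ := lt_of_le_of_ne (norm_nonneg _) (Ne.symm h0)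
    have h2 : ‖v‖ * ‖v‖ ≤ C * ‖v‖ := by simpa [sq] using this
    exact le_of_mul_le_mul_right h2 hpos

theorem norm_le_of_inner₂ {E : Type*} [NormedAddCommGroup E] [InnerProductSpace ℂ E]
    {u : E →L[ℂ] E} {C : ℝ} (hC : 0 ≤ C) (h : ∀ w v : E, ‖⟪w, u v⟫_ℂ‖ ≤ C * ‖v‖ * ‖w‖) :
    ‖u‖ ≤ C :=
  ContinuousLinearMap.opNorm_le_bound _ hC fun v =>
    norm_le_of_inner (by positivity) fun w => h w v

theorem norm_algFunctional_le (f : A →L[ℂ] ℂ) (g : B →L[ℂ] ℂ) (z : A ⊗[ℂ] B) :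
    ‖algFunctional f g z‖ ≤ ‖f‖ * ‖g‖ * ‖ofAlg π ρ z‖ := by
  let sl : A ⊗[ℂ] B →ₗ[ℂ] B :=
    TensorProduct.lift ((LinearMap.lsmul ℂ B).comp f.toLinearMap)
  have hsl : ∀ z, algFunctional f g z = g (sl z) := by
    intro z
    induction z using TensorProduct.induction_on with
    | zero => simp only [map_zero]
    | add x y hx hy => simp only [map_add, hx, hy]
    | tmul a b => simp [sl, algFunctional_tmul]
  have hbound : ‖sl z‖ ≤ ‖f‖ * ‖ofAlg π ρ z‖ := by
    rw [← ρ.norm_map]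
    refine norm_le_of_inner₂ (by positivity) fun w v => ?_
    let tl : A ⊗[ℂ] B →ₗ[ℂ] A := TensorProduct.lift
      ((LinearMap.lsmul ℂ A).comp ((innerSL ℂ w).toLinearMap ∘ₗ
        ((ContinuousLinearMap.apply ℂ K v).toLinearMap ∘ₗ (ρ.toHom : B →ₗ[ℂ] (K →L[ℂ] K))))).flip
    have htl : ∀ z, ⟪w, ρ.toHom (sl z) v⟫_ℂ = f (tl z) := by
      intro z
      induction z using TensorProduct.induction_on with
      | zero => simp only [map_zero, zero_apply, inner_zero_right]
      | add x y hx hy => simp only [map_add, add_apply, inner_add_right, hx, hy]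
      | tmul a b => simp [sl, tl, mul_comm]
    have htl2 : ‖tl z‖ ≤ ‖ofAlg π ρ z‖ * ‖v‖ * ‖w‖ := by
      rw [← π.norm_map]
      refine norm_le_of_inner₂ (by positivity) fun ξ' ξ => ?_
      have : ∀ z, ⟪ξ', π.toHom (tl z) ξ⟫_ℂ =
          ⟪htmul ξ' w, (π.tensor ρ).toHom (ofAlg π ρ z) (htmul ξ v)⟫_ℂ := by
        intro z
        induction z using TensorProduct.induction_on with
        | zero => simp only [map_zero, zero_apply, inner_zero_right]
        | add x y hx hy =>
          simp only [map_add, add_apply, inner_add_right, hx, hy]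
        | tmul a b =>
          simp [tl, ofAlg_tmul, tensor_tmul, opTensor_htmul, inner_htmul,
            mul_comm]
      rw [this]
      calc _ ≤ ‖htmul ξ' w‖ * ‖(π.tensor ρ).toHom (ofAlg π ρ z) (htmul ξ v)‖ :=
            norm_inner_le_norm _ _
        _ ≤ ‖htmul ξ' w‖ * (‖(π.tensor ρ).toHom (ofAlg π ρ z)‖ * ‖htmul ξ v‖) := by
            gcongr; exact ContinuousLinearMap.le_opNorm _ _
        _ = _ := by rw [FaithfulRep.norm_map, norm_htmul, norm_htmul]; ring
    rw [htl]
    calc ‖f (tl z)‖ ≤ ‖f‖ * ‖tl z‖ := f.le_opNorm _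
      _ ≤ ‖f‖ * (‖ofAlg π ρ z‖ * ‖v‖ * ‖w‖) := by gcongr
      _ = _ := by ring
  rw [hsl]
  calc ‖g (sl z)‖ ≤ ‖g‖ * ‖sl z‖ := g.le_opNorm _
    _ ≤ ‖g‖ * (‖f‖ * ‖ofAlg π ρ z‖) := by gcongr
    _ = _ := by ring

/-- The functional `f ⊗ g` on `A ⊗ B`: the unique continuous linear functional with
`(f ⊗ g) (a ⊗ b) = f a * g b`. -/
def tensorFunctional (f : A →L[ℂ] ℂ) (g : B →L[ℂ] ℂ) : MinTensor π ρ →L[ℂ] ℂ :=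
  (algFunctional f g).extendOfNorm (ofAlg π ρ)

theorem tensorFunctional_tmul (f : A →L[ℂ] ℂ) (g : B →L[ℂ] ℂ) (a : A) (b : B) :
    tensorFunctional π ρ f g (tmul π ρ a b) = f a * g b := by
  rw [← ofAlg_tmul, tensorFunctional, LinearMap.extendOfNorm_eq (ofAlg_dense π ρ)
    ⟨_, norm_algFunctional_le π ρ f g⟩, algFunctional_tmul]

theorem norm_tensorFunctional_le (f : A →L[ℂ] ℂ) (g : B →L[ℂ] ℂ) :
    ‖tensorFunctional π ρ f g‖ ≤ ‖f‖ * ‖g‖ :=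
  LinearMap.opNorm_extendOfNorm_le (ofAlg_dense π ρ) (by positivity)
    (norm_algFunctional_le π ρ f g)

end Functionals

section StrictExtension

variable {A : Type*} [NonUnitalCStarAlgebra A]

/-- `G` is the extension of the functional `F` on `A` to the multiplier algebra `M(A)` by strict
continuity: `G` agrees with `F` on `A`, and `G` is continuous, on bounded subsets of `M(A)`, for
the strict topology, i.e. the topology given by the seminorms `m ↦ ‖m x‖` and `m ↦ ‖x m‖` for
`x ∈ A`. -/
structure IsStrictExtension (F : A →L[ℂ] ℂ) (G : 𝓜(ℂ, A) →L[ℂ] ℂ) : Prop where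
  extends_coe : ∀ a : A, G (a : 𝓜(ℂ, A)) = F a
  strict : ∀ R ε : ℝ, 0 < ε → ∃ X : Finset A, ∃ d : ℝ, 0 < d ∧ ∀ m : 𝓜(ℂ, A), ‖m‖ ≤ R →
    (∀ x ∈ X, ‖m.fst x‖ < d ∧ ‖m.snd x‖ < d) → ‖G m‖ < ε

theorem exists_approximateUnit (A : Type*) [NonUnitalCStarAlgebra A] :
    ∃ l : Filter A, l.NeBot ∧ (∀ᶠ e in l, ‖e‖ ≤ 1 ∧ star e = e) ∧
      (∀ x, Tendsto (fun e => x * e) l (𝓝 x)) ∧ (∀ x, Tendsto (fun e => e * x) l (𝓝 x)) := by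
  let _ := CStarAlgebra.spectralOrder A
  let _ := CStarAlgebra.spectralOrderedRing A
  have h := CStarAlgebra.increasingApproximateUnit A
  exact ⟨_, h.neBot, h.eventually_norm.and h.eventually_star_eq, h.tendsto_mul_left,
    h.tendsto_mul_right⟩

theorem mul_left_faithful {u v : A} (h : ∀ y : A, y * u = y * v) : u = v := by
  have : star (u - v) * (u - v) = 0 := by rw [mul_sub, h, sub_self]
  exact sub_eq_zero.1 (CStarRing.star_mul_self_eq_zero_iff _ |>.1 this)

theorem fst_mul (m : 𝓜(ℂ, A)) (a b : A) : m.fst (a * b) = m.fst a * b :=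
  mul_left_faithful fun y => by
    rw [← m.central, ← mul_assoc, ← mul_assoc, ← m.central]

theorem mul_right_faithful {u v : A} (h : ∀ y : A, u * y = v * y) : u = v := by
  have : (u - v) * star (u - v) = 0 := by rw [sub_mul, h, sub_self]
  exact sub_eq_zero.1 (CStarRing.mul_star_self_eq_zero_iff _ |>.1 this)

theorem mul_coe (m : 𝓜(ℂ, A)) (a : A) : m * (a : 𝓜(ℂ, A)) = ((m.fst a : A) : 𝓜(ℂ, A)) := by
  apply DoubleCentralizer.ext
  refine Prod.ext (ContinuousLinearMap.ext fun x => ?_) (ContinuousLinearMap.ext fun x => ?_)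
  · exact fst_mul m a x
  · exact m.central x a

theorem norm_coe (a : A) : ‖(a : 𝓜(ℂ, A))‖ = ‖a‖ := by
  refine NonUnitalStarAlgHom.norm_map (DoubleCentralizer.coeHom (𝕜 := ℂ) (A := A)) ?_ a
  intro u v h
  refine mul_right_faithful fun y => ?_
  exact DFunLike.congr_fun (congrArg (fun m : 𝓜(ℂ, A) => m.fst) h) y

theorem norm_add_sq_le {M : Type*} [CStarAlgebra M] (a b : M) :
    ‖a + b‖ ^ 2 ≤ ‖a‖ ^ 2 + ‖b‖ ^ 2 + 2 * ‖a * star b‖ := by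
  have h1 : ‖b * star a‖ = ‖a * star b‖ := by
    rw [← norm_star (b * star a), star_mul, star_star]
  calc ‖a + b‖ ^ 2 = ‖(a + b) * star (a + b)‖ := by rw [CStarRing.norm_self_mul_star, sq]
    _ = ‖a * star a + b * star b + (a * star b + b * star a)‖ := by
        rw [star_add]; congr 1; noncomm_ring
    _ ≤ ‖a * star a‖ + ‖b * star b‖ + (‖a * star b‖ + ‖b * star a‖) :=
        (norm_add_le _ _).trans (add_le_add (norm_add_le _ _) (norm_add_le _ _))
    _ = _ := by
        rw [CStarRing.norm_self_mul_star, CStarRing.norm_self_mul_star, h1]; ring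

/-- For a norm-preserving extension `G` of `F`, and a suitable `e`, the number
`G (m) - F (m e)` is small uniformly for `‖m‖ ≤ 1`. -/
theorem exists_small (F : A →L[ℂ] ℂ) (G : 𝓜(ℂ, A) →L[ℂ] ℂ) (hG : ‖G‖ ≤ ‖F‖)
    (hGF : ∀ a : A, G (a : 𝓜(ℂ, A)) = F a) (ε : ℝ) (hε : 0 < ε) :
    ∃ e : A, ∀ m : 𝓜(ℂ, A), ‖m‖ ≤ 1 → ‖G m - F (m.fst e)‖ ≤ ε := by
  obtain ⟨l, hl, hl1, hl2, -⟩ := exists_approximateUnit A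
  set C := 4 * ‖F‖ + 1 with hC
  have hCpos : 0 < C := by positivity
  set t := min 1 (ε / C) with ht
  have htpos : 0 < t := by positivity
  have ht1 : t ≤ 1 := min_le_left _ _
  have htε : C * t ≤ ε := by
    have : t ≤ ε / C := min_le_right _ _
    rw [le_div_iff₀ hCpos] at this
    linarith
  obtain ⟨x₀, hx₀, hFx₀⟩ := F.exists_lt_apply_of_lt_opNorm
    (show ‖F‖ - t ^ 2 < ‖F‖ by linarith [pow_pos htpos 2])
  obtain ⟨c, hc, hcF⟩ := Complex.exists_norm_eq_mul_self (F x₀)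
  set x := c • x₀ with hx
  have hxn : ‖x‖ ≤ 1 := by rw [hx, norm_smul, hc, one_mul]; exact hx₀.le
  have hFx : F x = (‖F x₀‖ : ℂ) := by rw [hx, map_smul, smul_eq_mul, hcF]
  have hlim : ∀ᶠ e in l, ‖x - x * e‖ ≤ t ^ 2 := by
    have : Tendsto (fun e => ‖x - x * e‖) l (𝓝 0) := by
      simpa using ((tendsto_const_nhds (x := x)).sub (hl2 x)).norm
    exact (this.eventually (gt_mem_nhds (pow_pos htpos 2))).mono fun e he => he.le
  obtain ⟨e, ⟨he1, hes⟩, hη⟩ := (hl1.and hlim).exists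
  refine ⟨e, fun m hm => ?_⟩
  set w : 𝓜(ℂ, A) := m * (1 - (e : 𝓜(ℂ, A))) with hw
  have hGw : G w = G m - F (m.fst e) := by
    rw [hw, mul_sub, mul_one, map_sub, mul_coe, hGF]
  rw [← hGw]
  obtain ⟨k, hk, hkG⟩ := Complex.exists_norm_eq_mul_self (G w)
  set a : 𝓜(ℂ, A) := ((x * e : A) : 𝓜(ℂ, A)) with ha
  set b : 𝓜(ℂ, A) := ((t : ℂ) * k) • w with hb
  have hone : ‖(1 : 𝓜(ℂ, A))‖ ≤ 1 := by
    rw [← DoubleCentralizer.norm_fst]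
    exact ContinuousLinearMap.norm_id_le
  have hcoe : ‖(e : 𝓜(ℂ, A))‖ ≤ 1 := by rw [norm_coe]; exact he1
  have hsub : ‖(1 : 𝓜(ℂ, A)) - (e : 𝓜(ℂ, A))‖ ≤ 2 :=
    (norm_sub_le _ _).trans (by linarith)
  have hwn : ‖w‖ ≤ 2 := by
    calc ‖w‖ ≤ ‖m‖ * ‖(1 : 𝓜(ℂ, A)) - (e : 𝓜(ℂ, A))‖ := norm_mul_le _ _
      _ ≤ 1 * 2 := by gcongr
      _ = 2 := by norm_num
  have hbn : ‖b‖ ≤ 2 * t := by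
    rw [hb, norm_smul, norm_mul, hk, Complex.norm_real, Real.norm_of_nonneg htpos.le]
    nlinarith
  have han : ‖a‖ ≤ 1 := by
    rw [ha, norm_coe]
    calc ‖x * e‖ ≤ ‖x‖ * ‖e‖ := norm_mul_le _ _
      _ ≤ 1 * 1 := by gcongr
      _ = 1 := by norm_num
  have hestar : star (e : 𝓜(ℂ, A)) = (e : 𝓜(ℂ, A)) := by
    have := map_star (DoubleCentralizer.coeHom (𝕜 := ℂ) (A := A)) e
    rw [hes] at this
    exact this.symm
  have hcoemul : ∀ u v : A, ((u * v : A) : 𝓜(ℂ, A)) = (u : 𝓜(ℂ, A)) * (v : 𝓜(ℂ, A)) :=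
    fun u v => map_mul (DoubleCentralizer.coeHom (𝕜 := ℂ) (A := A)) u v
  have hcoesub : ∀ u v : A, ((u - v : A) : 𝓜(ℂ, A)) = (u : 𝓜(ℂ, A)) - (v : 𝓜(ℂ, A)) :=
    fun u v => map_sub (DoubleCentralizer.coeHom (𝕜 := ℂ) (A := A)) u v
  have hab : ‖a * star b‖ ≤ t * t ^ 2 := by
    have h1 : a * star w = ((x - x * e : A) : 𝓜(ℂ, A)) * (e : 𝓜(ℂ, A)) * star m := by
      rw [ha, hw, star_mul, star_sub, star_one, hestar, hcoesub, hcoemul]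
      noncomm_ring
    have h2 : ‖a * star w‖ ≤ t ^ 2 := by
      rw [h1]
      calc _ ≤ ‖((x - x * e : A) : 𝓜(ℂ, A))‖ * ‖(e : 𝓜(ℂ, A))‖ * ‖star m‖ :=
            (norm_mul_le _ _).trans (by gcongr; exact norm_mul_le _ _)
        _ ≤ t ^ 2 * 1 * 1 := by
            rw [norm_coe, norm_star]
            gcongr
        _ = t ^ 2 := by ring
    rw [hb, star_smul, mul_smul_comm, norm_smul, norm_star, norm_mul, hk, Complex.norm_real,
      Real.norm_of_nonneg htpos.le, mul_one]
    gcongr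
  have hsq : ‖a + b‖ ^ 2 ≤ (1 + 3 * t ^ 2) ^ 2 := by
    have := norm_add_sq_le a b
    have h1 : ‖a‖ ^ 2 ≤ 1 := by nlinarith [norm_nonneg a]
    have h2 : ‖b‖ ^ 2 ≤ 4 * t ^ 2 := by nlinarith [norm_nonneg b]
    have h3 : t * t ^ 2 ≤ t ^ 2 := by nlinarith [pow_pos htpos 2]
    have h4 : (1 + 3 * t ^ 2) ^ 2 = 1 + 6 * t ^ 2 + 9 * t ^ 4 := by ring
    have h5 : 0 < t ^ 4 := pow_pos htpos 4
    rw [h4]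
    linarith
  have hab' : ‖a + b‖ ≤ 1 + 3 * t ^ 2 := by
    have h0 : (0 : ℝ) ≤ 1 + 3 * t ^ 2 := by positivity
    exact le_of_sq_le_sq hsq h0
  have hGab : G (a + b) = F (x * e) + ((t * ‖G w‖ : ℝ) : ℂ) := by
    rw [map_add, ha, hGF, hb, map_smul, smul_eq_mul, mul_assoc, ← hkG]
    push_cast
    rfl
  have hre : (F (x * e)).re + t * ‖G w‖ ≤ ‖F‖ * (1 + 3 * t ^ 2) := by
    calc (F (x * e)).re + t * ‖G w‖ = (G (a + b)).re := by
          rw [hGab, Complex.add_re, Complex.ofReal_re]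
      _ ≤ ‖G (a + b)‖ := Complex.re_le_norm _
      _ ≤ ‖G‖ * ‖a + b‖ := G.le_opNorm _
      _ ≤ ‖F‖ * (1 + 3 * t ^ 2) := by gcongr
  have hFxe : ‖F‖ - t ^ 2 - ‖F‖ * t ^ 2 ≤ (F (x * e)).re := by
    have h1 : (F (x - x * e)).re ≤ ‖F‖ * t ^ 2 :=
      (Complex.re_le_norm _).trans ((F.le_opNorm _).trans (by gcongr))
    rw [map_sub, Complex.sub_re, hFx, Complex.ofReal_re] at h1
    linarith
  have hfin : t * ‖G w‖ ≤ t * (C * t) := by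
    have h1 : t * (C * t) = 4 * (‖F‖ * t ^ 2) + t ^ 2 := by rw [hC]; ring
    have h2 : ‖F‖ * (1 + 3 * t ^ 2) = ‖F‖ + 3 * (‖F‖ * t ^ 2) := by ring
    rw [h1]
    rw [h2] at hre
    linarith
  exact (le_of_mul_le_mul_left hfin htpos).trans htε

theorem exists_strictExtension (F : A →L[ℂ] ℂ) :
    ∃ G : 𝓜(ℂ, A) →L[ℂ] ℂ, IsStrictExtension F G ∧ ‖G‖ ≤ ‖F‖ := by
  let p : Submodule ℂ 𝓜(ℂ, A) :=
    LinearMap.range (DoubleCentralizer.coeHom (𝕜 := ℂ) (A := A) : A →ₗ[ℂ] 𝓜(ℂ, A))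
  have hinv : ∀ y : p, ∃ a : A, (a : 𝓜(ℂ, A)) = y := fun y => y.2
  choose r hr using hinv
  have hinj : ∀ u v : A, (u : 𝓜(ℂ, A)) = (v : 𝓜(ℂ, A)) → u = v := by
    intro u v h
    refine mul_right_faithful fun y => ?_
    exact DFunLike.congr_fun (congrArg (fun m : 𝓜(ℂ, A) => m.fst) h) y
  have hadd : ∀ u v : A, ((u + v : A) : 𝓜(ℂ, A)) = (u : 𝓜(ℂ, A)) + (v : 𝓜(ℂ, A)) :=
    fun u v => map_add (DoubleCentralizer.coeHom (𝕜 := ℂ) (A := A)) u v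
  have hsmul : ∀ (c : ℂ) (u : A), ((c • u : A) : 𝓜(ℂ, A)) = c • (u : 𝓜(ℂ, A)) :=
    fun c u => map_smul (DoubleCentralizer.coeHom (𝕜 := ℂ) (A := A)) c u
  let F₀ : p →L[ℂ] ℂ := LinearMap.mkContinuous
    { toFun := fun y => F (r y)
      map_add' := fun y z => by
        rw [← map_add]
        refine congrArg F (hinj _ _ ?_)
        rw [hadd, hr, hr, hr, Submodule.coe_add]
      map_smul' := fun c y => by
        rw [RingHom.id_apply, ← map_smul]
        refine congrArg F (hinj _ _ ?_)
        rw [hsmul, hr, hr, Submodule.coe_smul] } ‖F‖ fun y => by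
      have h1 : ‖r y‖ = ‖y‖ := by rw [← norm_coe, hr, Submodule.coe_norm]
      rw [← h1]
      exact F.le_opNorm _
  obtain ⟨G, hG, hGn⟩ := exists_extension_norm_eq p F₀
  have hGF : ∀ a : A, G (a : 𝓜(ℂ, A)) = F a := by
    intro a
    have h := hG ⟨(a : 𝓜(ℂ, A)), ⟨a, rfl⟩⟩
    refine h.trans ?_
    exact congrArg F (hinj _ _ (hr _))
  have hGle : ‖G‖ ≤ ‖F‖ := by
    rw [hGn]
    exact LinearMap.mkContinuous_norm_le _ (norm_nonneg _) _
  refine ⟨G, ⟨hGF, fun R ε hε => ?_⟩, hGle⟩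
  have hR : 0 < |R| + 1 := by positivity
  obtain ⟨e, he⟩ := exists_small F G hGle hGF (ε / (2 * (|R| + 1))) (by positivity)
  refine ⟨{e}, ε / (2 * (‖F‖ + 1)), by positivity, fun m hm hX => ?_⟩
  have hme := (hX e (Finset.mem_singleton_self e)).1
  have h1 : ‖G m - F (m.fst e)‖ ≤ ε / 2 := by
    have h2 := he (((|R| + 1 : ℝ) : ℂ)⁻¹ • m) (by
      rw [norm_smul, norm_inv, Complex.norm_real, Real.norm_of_nonneg hR.le, inv_mul_le_iff₀ hR]
      have := le_abs_self R
      linarith)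
    rw [map_smul, DoubleCentralizer.smul_fst, smul_apply, map_smul,
      ← smul_sub, norm_smul, norm_inv, Complex.norm_real, Real.norm_of_nonneg hR.le,
      inv_mul_le_iff₀ hR] at h2
    refine h2.trans (le_of_eq ?_)
    field_simp
  have h3 : ‖F (m.fst e)‖ < ε / 2 := by
    calc ‖F (m.fst e)‖ ≤ ‖F‖ * ‖m.fst e‖ := F.le_opNorm _
      _ ≤ (‖F‖ + 1) * ‖m.fst e‖ := by gcongr; linarith
      _ < (‖F‖ + 1) * (ε / (2 * (‖F‖ + 1))) := by gcongr
      _ = ε / 2 := by field_simp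
  calc ‖G m‖ = ‖(G m - F (m.fst e)) + F (m.fst e)‖ := by rw [sub_add_cancel]
    _ ≤ ‖G m - F (m.fst e)‖ + ‖F (m.fst e)‖ := norm_add_le _ _
    _ < ε := by linarith

theorem IsStrictExtension.unique {F : A →L[ℂ] ℂ} {G G' : 𝓜(ℂ, A) →L[ℂ] ℂ}
    (h : IsStrictExtension F G) (h' : IsStrictExtension F G') : G = G' := by
  ext m
  rw [← sub_eq_zero, ← norm_le_zero_iff]
  refine le_of_forall_pos_lt_add fun ε hε => ?_
  obtain ⟨l, hl, hl1, hl2, hl3⟩ := exists_approximateUnit A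
  obtain ⟨X, d, hd, hX⟩ := h.strict (2 * ‖m‖) (ε / 2) (by positivity)
  obtain ⟨X', d', hd', hX'⟩ := h'.strict (2 * ‖m‖) (ε / 2) (by positivity)
  have hlim : ∀ (x : A) (d : ℝ), 0 < d → ∀ᶠ e in l,
      ‖(m - ((m.fst e : A) : 𝓜(ℂ, A))).fst x‖ < d ∧
      ‖(m - ((m.fst e : A) : 𝓜(ℂ, A))).snd x‖ < d := by
    intro x d hd
    have h1 : Tendsto (fun e => ‖(m - ((m.fst e : A) : 𝓜(ℂ, A))).fst x‖) l (𝓝 0) := by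
      have h2 : Tendsto (fun e => ‖m.fst (x - e * x)‖) l (𝓝 0) := by
        have := (m.fst.continuous.tendsto _).comp ((tendsto_const_nhds (x := x)).sub (hl3 x))
        simpa using this.norm
      refine h2.congr fun e => ?_
      rw [map_sub, fst_mul]
      rfl
    have h3 : Tendsto (fun e => ‖(m - ((m.fst e : A) : 𝓜(ℂ, A))).snd x‖) l (𝓝 0) := by
      have h2 : Tendsto (fun e => ‖m.snd x - m.snd x * e‖) l (𝓝 0) := by
        simpa using ((tendsto_const_nhds (x := m.snd x)).sub (hl2 (m.snd x))).norm
      refine h2.congr fun e => ?_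
      rw [m.central]
      rfl
    exact (h1.eventually (gt_mem_nhds hd)).and (h3.eventually (gt_mem_nhds hd))
  obtain ⟨e, ⟨he1, -⟩, heX, heX'⟩ := (hl1.and
    (((Filter.eventually_all_finset X).2 fun x _ => hlim x d hd).and
      ((Filter.eventually_all_finset X').2 fun x _ => hlim x d' hd'))).exists
  have hn : ‖m - ((m.fst e : A) : 𝓜(ℂ, A))‖ ≤ 2 * ‖m‖ := by
    have h1 : ‖m.fst e‖ ≤ ‖m‖ := by
      calc ‖m.fst e‖ ≤ ‖m.fst‖ * ‖e‖ := m.fst.le_opNorm _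
        _ ≤ ‖m‖ * 1 := by rw [DoubleCentralizer.norm_fst]; gcongr
        _ = ‖m‖ := mul_one _
    calc _ ≤ ‖m‖ + ‖((m.fst e : A) : 𝓜(ℂ, A))‖ := norm_sub_le _ _
      _ ≤ _ := by rw [norm_coe]; linarith
  have k1 := hX _ hn heX
  have k2 := hX' _ hn heX'
  have k3 : G m - G' m = G (m - ((m.fst e : A) : 𝓜(ℂ, A))) -
      G' (m - ((m.fst e : A) : 𝓜(ℂ, A))) := by
    rw [map_sub, map_sub, h.extends_coe, h'.extends_coe]
    ring
  rw [k3, zero_add]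
  calc _ ≤ _ := norm_sub_le _ _
    _ < ε := by linarith

/-- The strictly continuous extension of a functional on `A` to the multiplier algebra. -/
def strictExtension (F : A →L[ℂ] ℂ) : 𝓜(ℂ, A) →L[ℂ] ℂ :=
  (exists_strictExtension F).choose

theorem isStrictExtension (F : A →L[ℂ] ℂ) : IsStrictExtension F (strictExtension F) :=
  (exists_strictExtension F).choose_spec.1

theorem norm_strictExtension_le (F : A →L[ℂ] ℂ) : ‖strictExtension F‖ ≤ ‖F‖ :=
  (exists_strictExtension F).choose_spec.2

end StrictExtension

section Legs

variable {H₁ H₂ H₃ : Type*} [NormedAddCommGroup H₁] [InnerProductSpace ℂ H₁]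
  [NormedAddCommGroup H₂] [InnerProductSpace ℂ H₂]
  [NormedAddCommGroup H₃] [InnerProductSpace ℂ H₃]

theorem continuous_htmul_left (η : H₂) : Continuous fun ξ : H₁ => htmul ξ η :=
  hcoe.continuous.comp (TensorProduct.continuous_tmul.comp (by fun_prop : Continuous
    fun ξ : H₁ => (ξ, η)))

theorem continuous_htmul_right (ξ : H₁) : Continuous fun η : H₂ => htmul ξ η :=
  hcoe.continuous.comp (TensorProduct.continuous_tmul.comp (by fun_prop : Continuous
    fun η : H₂ => (ξ, η)))

/-- `(H₁ ⊙ H₂) ⊙ H₃ → (H₁ ⊗ H₂) ⊗ H₃`. -/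
def hcoeLeft : (H₁ ⊗[ℂ] H₂) ⊗[ℂ] H₃ →ₗᵢ[ℂ] HTensor (HTensor H₁ H₂) H₃ :=
  hcoe.comp (hcoe.rTensor H₃)

/-- `H₁ ⊙ (H₂ ⊙ H₃) → H₁ ⊗ (H₂ ⊗ H₃)`. -/
def hcoeRight : H₁ ⊗[ℂ] (H₂ ⊗[ℂ] H₃) →ₗᵢ[ℂ] HTensor H₁ (HTensor H₂ H₃) :=
  hcoe.comp (hcoe.lTensor H₁)

theorem hcoeLeft_dense :
    DenseRange (hcoeLeft : (H₁ ⊗[ℂ] H₂) ⊗[ℂ] H₃ → HTensor (HTensor H₁ H₂) H₃) := by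
  let p := (LinearMap.range (hcoeLeft (H₁ := H₁) (H₂ := H₂) (H₃ := H₃)).toLinearMap)
  have hsub : ∀ (v : HTensor H₁ H₂) (ζ : H₃), htmul v ζ ∈ p.topologicalClosure := by
    intro v ζ
    refine hcoe_dense.induction (P := fun v => htmul v ζ ∈ p.topologicalClosure) ?_
      ((Submodule.isClosed_topologicalClosure p).preimage (continuous_htmul_left ζ)) v
    rintro _ ⟨z, rfl⟩
    exact Submodule.le_topologicalClosure p ⟨z ⊗ₜ ζ, rfl⟩
  have hle : Submodule.span ℂ {v : HTensor (HTensor H₁ H₂) H₃ | ∃ ξ η, v = htmul ξ η} ≤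
      p.topologicalClosure := by
    rw [Submodule.span_le]
    rintro _ ⟨v, ζ, rfl⟩
    exact hsub v ζ
  intro y
  have hy : y ∈ closure (p.topologicalClosure : Set (HTensor (HTensor H₁ H₂) H₃)) :=
    (htmul_span_dense.mono hle) y
  rw [(Submodule.isClosed_topologicalClosure p).closure_eq] at hy
  exact hy

theorem hcoeRight_dense :
    DenseRange (hcoeRight : H₁ ⊗[ℂ] (H₂ ⊗[ℂ] H₃) → HTensor H₁ (HTensor H₂ H₃)) := by
  let p := (LinearMap.range (hcoeRight (H₁ := H₁) (H₂ := H₂) (H₃ := H₃)).toLinearMap)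
  have hsub : ∀ (ξ : H₁) (v : HTensor H₂ H₃), htmul ξ v ∈ p.topologicalClosure := by
    intro ξ v
    refine hcoe_dense.induction (P := fun v => htmul ξ v ∈ p.topologicalClosure) ?_
      ((Submodule.isClosed_topologicalClosure p).preimage (continuous_htmul_right ξ)) v
    rintro _ ⟨z, rfl⟩
    exact Submodule.le_topologicalClosure p ⟨ξ ⊗ₜ z, rfl⟩
  have hle : Submodule.span ℂ {v : HTensor H₁ (HTensor H₂ H₃) | ∃ ξ η, v = htmul ξ η} ≤
      p.topologicalClosure := by
    rw [Submodule.span_le]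
    rintro _ ⟨ξ, v, rfl⟩
    exact hsub ξ v
  intro y
  have hy : y ∈ closure (p.topologicalClosure : Set (HTensor H₁ (HTensor H₂ H₃))) :=
    (htmul_span_dense.mono hle) y
  rw [(Submodule.isClosed_topologicalClosure p).closure_eq] at hy
  exact hy

/-- The associativity unitary `(H₁ ⊗ H₂) ⊗ H₃ ≃ H₁ ⊗ (H₂ ⊗ H₃)`. -/
def hassoc : HTensor (HTensor H₁ H₂) H₃ ≃ₗᵢ[ℂ] HTensor H₁ (HTensor H₂ H₃) :=
  LinearEquiv.extendOfIsometry (TensorProduct.assoc ℂ H₁ H₂ H₃) hcoeLeft.toLinearMap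
    hcoeRight.toLinearMap hcoeLeft_dense hcoeRight_dense fun x =>
      (hcoeRight.norm_map _).trans ((TensorProduct.norm_assoc x).trans (hcoeLeft.norm_map x).symm)

theorem hassoc_htmul (ξ : H₁) (η : H₂) (ζ : H₃) :
    hassoc (htmul (htmul ξ η) ζ) = htmul ξ (htmul η ζ) :=
  LinearEquiv.extendOfIsometry_eq (TensorProduct.assoc ℂ H₁ H₂ H₃) hcoeLeft.toLinearMap
    hcoeRight.toLinearMap hcoeLeft_dense hcoeRight_dense _ ((ξ ⊗ₜ η) ⊗ₜ ζ)

theorem hassoc_symm_htmul (ξ : H₁) (η : H₂) (ζ : H₃) :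
    hassoc.symm (htmul ξ (htmul η ζ)) = htmul (htmul ξ η) ζ := by
  rw [← hassoc_htmul, LinearIsometryEquiv.symm_apply_apply]

theorem norm_opTensor_le (a : H₁ →L[ℂ] H₁) (b : H₂ →L[ℂ] H₂) :
    ‖opTensor a b‖ ≤ ‖a‖ * ‖b‖ := by
  have h := ContinuousLinearMap.opNorm_extend_le
    (hcoe.toContinuousLinearMap ∘L TensorProduct.mapL a b)
    (e := (hcoe (H := H₁) (K := H₂)).toContinuousLinearMap) (N := 1) hcoe_dense
    (fun x => by simp)
  refine h.trans ?_
  rw [NNReal.coe_one, one_mul]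
  refine (ContinuousLinearMap.opNorm_le_bound _ (by positivity) fun x => ?_)
  calc _ = ‖TensorProduct.mapL a b x‖ := hcoe.norm_map _
    _ ≤ ‖TensorProduct.mapL a b‖ * ‖x‖ := ContinuousLinearMap.le_opNorm _ _
    _ ≤ ‖a‖ * ‖b‖ * ‖x‖ := by gcongr; exact TensorProduct.norm_mapL_le a b

theorem continuous_opTensor_right (a : H₁ →L[ℂ] H₁) :
    Continuous fun b : H₂ →L[ℂ] H₂ => opTensor a b :=
  (LinearMap.mkContinuous
    ({ toFun := fun b => opTensor a b
       map_add' := opTensor_add_right a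
       map_smul' := fun c b => opTensor_smul_right c a b } :
      (H₂ →L[ℂ] H₂) →ₗ[ℂ] (HTensor H₁ H₂ →L[ℂ] HTensor H₁ H₂))
    ‖a‖ (norm_opTensor_le a)).continuous

/-- The operator `b ⊗ x` on `H₁ ⊗ (H₂ ⊗ H₃)`, moved to `(H₁ ⊗ H₂) ⊗ H₃`. -/
def opAssoc (b : H₁ →L[ℂ] H₁) (x : HTensor H₂ H₃ →L[ℂ] HTensor H₂ H₃) :
    HTensor (HTensor H₁ H₂) H₃ →L[ℂ] HTensor (HTensor H₁ H₂) H₃ :=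
  (hassoc (H₁ := H₁) (H₂ := H₂) (H₃ := H₃)).symm.toLinearIsometry.toContinuousLinearMap ∘L
    (opTensor b x ∘L
      (hassoc (H₁ := H₁) (H₂ := H₂) (H₃ := H₃)).toLinearIsometry.toContinuousLinearMap)

theorem opAssoc_opTensor (a : H₁ →L[ℂ] H₁) (b : H₂ →L[ℂ] H₂) (c : H₃ →L[ℂ] H₃) :
    opAssoc a (opTensor b c) = opTensor (opTensor a b) c := by
  apply clm_ext_htmul
  intro v ζ
  refine hcoe_dense.induction (P := fun v => opAssoc a (opTensor b c) (htmul v ζ) =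
    opTensor (opTensor a b) c (htmul v ζ)) ?_ (isClosed_eq ?_ ?_) v
  · rintro _ ⟨z, rfl⟩
    induction z using TensorProduct.induction_on with
    | zero =>
      have : htmul (hcoe (0 : H₁ ⊗[ℂ] H₂)) ζ = 0 := by simp [htmul]
      rw [this, map_zero, map_zero]
    | add x y hx hy => rw [map_add, htmul_add_left, map_add, map_add, hx, hy]
    | tmul ξ η =>
      change opAssoc a (opTensor b c) (htmul (htmul ξ η) ζ) = _
      change hassoc.symm (opTensor a (opTensor b c) (hassoc (htmul (htmul ξ η) ζ))) =
        opTensor (opTensor a b) c (htmul (htmul ξ η) ζ)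
      simp only [hassoc_htmul, opTensor_htmul, hassoc_symm_htmul]
  · exact (opAssoc a (opTensor b c)).continuous.comp (continuous_htmul_left ζ)
  · exact (opTensor (opTensor a b) c).continuous.comp (continuous_htmul_left ζ)

end Legs

section LegElements

variable {A B C H₁ H₂ H₃ : Type*} [NonUnitalCStarAlgebra A] [NonUnitalCStarAlgebra B]
  [NonUnitalCStarAlgebra C]
  [NormedAddCommGroup H₁] [InnerProductSpace ℂ H₁] [CompleteSpace H₁]
  [NormedAddCommGroup H₂] [InnerProductSpace ℂ H₂] [CompleteSpace H₂]
  [NormedAddCommGroup H₃] [InnerProductSpace ℂ H₃] [CompleteSpace H₃]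
  (π : FaithfulRep A H₁) (ρ : FaithfulRep B H₂) (σ : FaithfulRep C H₃)

/-- If a continuous linear map sends elementary tensors into a closed subspace, it sends all of
`A ⊗ B` there. -/
theorem minTensor_induction {E : Type*} [NormedAddCommGroup E] [NormedSpace ℂ E]
    (p : Submodule ℂ E) (hp : IsClosed (p : Set E)) (u : MinTensor π ρ →L[ℂ] E)
    (h : ∀ a b, u (tmul π ρ a b) ∈ p) (x : MinTensor π ρ) : u x ∈ p := by
  refine (ofAlg_dense π ρ).induction (P := fun x => u x ∈ p) ?_ (hp.preimage u.continuous) x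
  rintro _ ⟨z, rfl⟩
  induction z using TensorProduct.induction_on with
  | zero => simp only [map_zero]; exact p.zero_mem
  | add x y hx hy => simp only [map_add]; exact p.add_mem hx hy
  | tmul a b => exact h a b

/-- The inclusion `A ⊗ B ⊆ B(H₁ ⊗ H₂)` as a continuous linear map. -/
def inclL : MinTensor π ρ →L[ℂ] (HTensor H₁ H₂ →L[ℂ] HTensor H₁ H₂) :=
  LinearMap.mkContinuous ((π.tensor ρ).toHom : MinTensor π ρ →ₗ[ℂ] _) 1 fun x => by
    rw [one_mul]; exact ((π.tensor ρ).norm_map x).le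

theorem opAssoc_mem (a : A) (x : MinTensor ρ σ) :
    opAssoc (π.toHom a) ((ρ.tensor σ).toHom x) ∈ minTensor (π.tensor ρ) σ := by
  let u : (HTensor H₂ H₃ →L[ℂ] HTensor H₂ H₃) →L[ℂ]
      (HTensor (HTensor H₁ H₂) H₃ →L[ℂ] HTensor (HTensor H₁ H₂) H₃) :=
    { toFun := fun x => opAssoc (π.toHom a) x
      map_add' := fun x y => by
        simp only [opAssoc, opTensor_add_right, ContinuousLinearMap.add_comp,
          ContinuousLinearMap.comp_add]
      map_smul' := fun c x => by
        simp only [opAssoc, opTensor_smul_right, ContinuousLinearMap.smul_comp,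
          ContinuousLinearMap.comp_smul, RingHom.id_apply]
      cont := continuous_const.clm_comp ((continuous_opTensor_right _).clm_comp continuous_const) }
  refine minTensor_induction ρ σ (minTensor (π.tensor ρ) σ).toNonUnitalSubalgebra.toSubmodule
    (isClosed_minTensor _ _) (u ∘L inclL ρ σ) (fun b c => ?_) x
  change opAssoc (π.toHom a) (opTensor (ρ.toHom b) (σ.toHom c)) ∈ minTensor (π.tensor ρ) σ
  rw [opAssoc_opTensor]
  exact (tmul (π.tensor ρ) σ (tmul π ρ a b) c).2

/-- For `a ∈ A` and `x ∈ B ⊗ C`, the element `a ⊗ x` of `A ⊗ B ⊗ C = (A ⊗ B) ⊗ C`. -/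
def tmulAssoc (a : A) (x : MinTensor ρ σ) : MinTensor (π.tensor ρ) σ :=
  ⟨opAssoc (π.toHom a) ((ρ.tensor σ).toHom x), opAssoc_mem π ρ σ a x⟩

theorem tmulAssoc_tmul (a : A) (b : B) (c : C) :
    tmulAssoc π ρ σ a (tmul ρ σ b c) = tmul (π.tensor ρ) σ (tmul π ρ a b) c :=
  Subtype.ext (opAssoc_opTensor _ _ _)

/-- Left multiplication of `A ⊗ B` by an operator on `H₁ ⊗ H₂`. -/
def opLeft (m : HTensor H₁ H₂ →L[ℂ] HTensor H₁ H₂)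
    (hl : ∀ a b, m * (π.tensor ρ).toHom (tmul π ρ a b) ∈ minTensor π ρ) :
    MinTensor π ρ →L[ℂ] MinTensor π ρ :=
  have hm : ∀ x, m * (π.tensor ρ).toHom x ∈ minTensor π ρ := fun x =>
    minTensor_induction π ρ (minTensor π ρ).toNonUnitalSubalgebra.toSubmodule
      (isClosed_minTensor π ρ)
      (ContinuousLinearMap.mul ℂ (HTensor H₁ H₂ →L[ℂ] HTensor H₁ H₂) m ∘L inclL π ρ) hl x
  LinearMap.mkContinuous
    { toFun := fun x => (⟨m * (π.tensor ρ).toHom x, hm x⟩ : minTensor π ρ)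
      map_add' := fun x y => Subtype.ext
        ((congrArg (m * ·) (map_add (π.tensor ρ).toHom x y)).trans (mul_add _ _ _))
      map_smul' := fun c x => Subtype.ext
        ((congrArg (m * ·) (map_smul (π.tensor ρ).toHom c x)).trans (mul_smul_comm _ _ _)) }
    ‖m‖ fun x => by
      have h : ‖m * (π.tensor ρ).toHom x‖ ≤ ‖m‖ * ‖x‖ :=
        (norm_mul_le _ _).trans_eq (by rw [FaithfulRep.norm_map])
      exact h

/-- Right multiplication of `A ⊗ B` by an operator on `H₁ ⊗ H₂`. -/
def opRight (m : HTensor H₁ H₂ →L[ℂ] HTensor H₁ H₂)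
    (hr : ∀ a b, (π.tensor ρ).toHom (tmul π ρ a b) * m ∈ minTensor π ρ) :
    MinTensor π ρ →L[ℂ] MinTensor π ρ :=
  have hm : ∀ x, (π.tensor ρ).toHom x * m ∈ minTensor π ρ := fun x =>
    minTensor_induction π ρ (minTensor π ρ).toNonUnitalSubalgebra.toSubmodule
      (isClosed_minTensor π ρ)
      ((ContinuousLinearMap.mul ℂ (HTensor H₁ H₂ →L[ℂ] HTensor H₁ H₂)).flip m ∘L inclL π ρ) hr x
  LinearMap.mkContinuous
    { toFun := fun x => (⟨(π.tensor ρ).toHom x * m, hm x⟩ : minTensor π ρ)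
      map_add' := fun x y => Subtype.ext
        ((congrArg (· * m) (map_add (π.tensor ρ).toHom x y)).trans (add_mul _ _ _))
      map_smul' := fun c x => Subtype.ext
        ((congrArg (· * m) (map_smul (π.tensor ρ).toHom c x)).trans (smul_mul_assoc _ _ _)) }
    ‖m‖ fun x => by
      have h : ‖(π.tensor ρ).toHom x * m‖ ≤ ‖m‖ * ‖x‖ :=
        (norm_mul_le _ _).trans_eq (by rw [FaithfulRep.norm_map, mul_comm])
      exact h

/-- An operator `m` on `H₁ ⊗ H₂` that multiplies `A ⊗ B` into itself from both sides, as a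
multiplier of `A ⊗ B`. -/
def opMultiplier (m : HTensor H₁ H₂ →L[ℂ] HTensor H₁ H₂)
    (hl : ∀ a b, m * (π.tensor ρ).toHom (tmul π ρ a b) ∈ minTensor π ρ)
    (hr : ∀ a b, (π.tensor ρ).toHom (tmul π ρ a b) * m ∈ minTensor π ρ) :
    𝓜(ℂ, MinTensor π ρ) where
  fst := opLeft π ρ m hl
  snd := opRight π ρ m hr
  central := fun _ _ => Subtype.ext (mul_assoc _ _ _)

/-- The multiplier `1 ⊗ b` of `A ⊗ B`. -/
def oneTmul (b : B) : 𝓜(ℂ, MinTensor π ρ) :=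
  opMultiplier π ρ (opTensor 1 (ρ.toHom b))
    (fun a b' => by
      rw [tensor_tmul, opTensor_mul, one_mul, ← map_mul]
      exact (tmul π ρ a (b * b')).2)
    (fun a b' => by
      rw [tensor_tmul, opTensor_mul, mul_one, ← map_mul]
      exact (tmul π ρ a (b' * b)).2)

/-- The multiplier `a ⊗ 1` of `A ⊗ B`. -/
def tmulOne (a : A) : 𝓜(ℂ, MinTensor π ρ) :=
  opMultiplier π ρ (opTensor (π.toHom a) 1)
    (fun a' b => by
      rw [tensor_tmul, opTensor_mul, one_mul, ← map_mul]
      exact (tmul π ρ (a * a') b).2)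
    (fun a' b => by
      rw [tensor_tmul, opTensor_mul, mul_one, ← map_mul]
      exact (tmul π ρ (a' * a) b).2)

theorem oneTmul_fst_tmul (b b' : B) (a : A) :
    (oneTmul π ρ b).fst (tmul π ρ a b') = tmul π ρ a (b * b') :=
  (π.tensor ρ).injective (by
    change opTensor 1 (ρ.toHom b) * opTensor (π.toHom a) (ρ.toHom b') =
      opTensor (π.toHom a) (ρ.toHom (b * b'))
    rw [opTensor_mul, one_mul, ← map_mul])

theorem tmulOne_fst_tmul (a a' : A) (b : B) :
    (tmulOne π ρ a).fst (tmul π ρ a' b) = tmul π ρ (a * a') b :=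
  (π.tensor ρ).injective (by
    change opTensor (π.toHom a) 1 * opTensor (π.toHom a') (ρ.toHom b) =
      opTensor (π.toHom (a * a')) (ρ.toHom b)
    rw [opTensor_mul, one_mul, ← map_mul])

end LegElements

section Bilinearity

theorem IsStrictExtension.add {A : Type*} [NonUnitalCStarAlgebra A] {F F' : A →L[ℂ] ℂ}
    {G G' : 𝓜(ℂ, A) →L[ℂ] ℂ} (h : IsStrictExtension F G) (h' : IsStrictExtension F' G') :
    IsStrictExtension (F + F') (G + G') where
  extends_coe a := by simp only [add_apply, h.extends_coe, h'.extends_coe]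
  strict R ε hε := by
    classical
    obtain ⟨X, d, hd, hX⟩ := h.strict R (ε / 2) (by positivity)
    obtain ⟨X', d', hd', hX'⟩ := h'.strict R (ε / 2) (by positivity)
    refine ⟨X ∪ X', min d d', lt_min hd hd', fun m hm hmX => ?_⟩
    have h1 := hX m hm fun x hx =>
      ⟨(hmX x (Finset.mem_union_left _ hx)).1.trans_le (min_le_left _ _),
        (hmX x (Finset.mem_union_left _ hx)).2.trans_le (min_le_left _ _)⟩
    have h2 := hX' m hm fun x hx =>
      ⟨(hmX x (Finset.mem_union_right _ hx)).1.trans_le (min_le_right _ _),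
        (hmX x (Finset.mem_union_right _ hx)).2.trans_le (min_le_right _ _)⟩
    calc ‖(G + G') m‖ ≤ ‖G m‖ + ‖G' m‖ := norm_add_le _ _
      _ < ε := by linarith

theorem IsStrictExtension.smul {A : Type*} [NonUnitalCStarAlgebra A] {F : A →L[ℂ] ℂ}
    {G : 𝓜(ℂ, A) →L[ℂ] ℂ} (c : ℂ) (h : IsStrictExtension F G) :
    IsStrictExtension (c • F) (c • G) where
  extends_coe a := by simp only [smul_apply, h.extends_coe]
  strict R ε hε := by
    obtain ⟨X, d, hd, hX⟩ := h.strict R (ε / (‖c‖ + 1)) (by positivity)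
    refine ⟨X, d, hd, fun m hm hmX => ?_⟩
    have h1 := hX m hm hmX
    rw [lt_div_iff₀ (by positivity)] at h1
    calc ‖(c • G) m‖ = ‖c‖ * ‖G m‖ := by rw [smul_apply, norm_smul]
      _ ≤ ‖G m‖ * (‖c‖ + 1) := by nlinarith [norm_nonneg (G m)]
      _ < ε := h1

theorem strictExtension_add {A : Type*} [NonUnitalCStarAlgebra A] (F F' : A →L[ℂ] ℂ) :
    strictExtension (F + F') = strictExtension F + strictExtension F' :=
  (isStrictExtension _).unique ((isStrictExtension F).add (isStrictExtension F'))

theorem strictExtension_smul {A : Type*} [NonUnitalCStarAlgebra A] (c : ℂ) (F : A →L[ℂ] ℂ) :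
    strictExtension (c • F) = c • strictExtension F :=
  (isStrictExtension _).unique ((isStrictExtension F).smul c)

variable {A B H K : Type*} [NonUnitalCStarAlgebra A] [NonUnitalCStarAlgebra B]
  [NormedAddCommGroup H] [InnerProductSpace ℂ H] [CompleteSpace H]
  [NormedAddCommGroup K] [InnerProductSpace ℂ K] [CompleteSpace K]
  (π : FaithfulRep A H) (ρ : FaithfulRep B K)

theorem tensorFunctional_add_left (f f' : A →L[ℂ] ℂ) (g : B →L[ℂ] ℂ) :
    tensorFunctional π ρ (f + f') g = tensorFunctional π ρ f g + tensorFunctional π ρ f' g :=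
  clm_ext_tmul π ρ fun a b => by
    simp only [add_apply, tensorFunctional_tmul, add_mul]

theorem tensorFunctional_add_right (f : A →L[ℂ] ℂ) (g g' : B →L[ℂ] ℂ) :
    tensorFunctional π ρ f (g + g') = tensorFunctional π ρ f g + tensorFunctional π ρ f g' :=
  clm_ext_tmul π ρ fun a b => by
    simp only [add_apply, tensorFunctional_tmul, mul_add]

theorem tensorFunctional_smul_left (c : ℂ) (f : A →L[ℂ] ℂ) (g : B →L[ℂ] ℂ) :
    tensorFunctional π ρ (c • f) g = c • tensorFunctional π ρ f g :=
  clm_ext_tmul π ρ fun a b => by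
    simp only [smul_apply, tensorFunctional_tmul, smul_eq_mul, mul_assoc]

theorem tensorFunctional_smul_right (c : ℂ) (f : A →L[ℂ] ℂ) (g : B →L[ℂ] ℂ) :
    tensorFunctional π ρ f (c • g) = c • tensorFunctional π ρ f g :=
  clm_ext_tmul π ρ fun a b => by
    simp only [smul_apply, tensorFunctional_tmul, smul_eq_mul, mul_left_comm]

end Bilinearity

section HopfAlgebra

variable {S H : Type*} [NonUnitalCStarAlgebra S]
  [NormedAddCommGroup H] [InnerProductSpace ℂ H] [CompleteSpace H]

/-- A Hopf C⋆-algebra structure on the C⋆-algebra `S`. The faithful representation `π` of `S` only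
serves to realize the minimal tensor products `S ⊗ S` and `S ⊗ S ⊗ S`, which up to canonical
isomorphism do not depend on it. -/
structure HopfCStarAlgebra (π : FaithfulRep S H) where
  /-- The comultiplication `δ : S → M(S ⊗ S)`, a `*`-homomorphism. -/
  comul : S →⋆ₙₐ[ℂ] 𝓜(ℂ, MinTensor π π)
  /-- `δ` is non-degenerate: the span of `δ(S)(S ⊗ S)` is dense in `S ⊗ S`. -/
  nondegenerate : Dense (Submodule.span ℂ
    {y : MinTensor π π | ∃ s x, y = (comul s).fst x} : Set (MinTensor π π))
  /-- Coassociativity `(δ ⊗ id) δ = (id ⊗ δ) δ`. Here `Φ = δ ⊗ id` and `Ψ = id ⊗ δ` are the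
  (unique) unital `*`-homomorphisms `M(S ⊗ S) → M(S ⊗ S ⊗ S)` with `Φ (a ⊗ c) = δ(a) ⊗ c` and
  `Ψ (a ⊗ c) = a ⊗ δ(c)`, where `(δ(a) ⊗ c) (x ⊗ d) = δ(a) x ⊗ c d` and
  `(a ⊗ δ(c)) (b ⊗ x) = a b ⊗ δ(c) x` for `b, d ∈ S` and `x ∈ S ⊗ S`. -/
  coassoc : ∃ Φ Ψ : 𝓜(ℂ, MinTensor π π) →⋆ₐ[ℂ] 𝓜(ℂ, MinTensor (π.tensor π) π),
    (∀ (a c d : S) (x : MinTensor π π),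
      (Φ (tmul π π a c : 𝓜(ℂ, MinTensor π π))).fst (tmul (π.tensor π) π x d) =
        tmul (π.tensor π) π ((comul a).fst x) (c * d)) ∧
    (∀ (a b c : S) (x : MinTensor π π),
      (Ψ (tmul π π a c : 𝓜(ℂ, MinTensor π π))).fst (tmulAssoc π π π b x) =
        tmulAssoc π π π (a * b) ((comul c).fst x)) ∧
    ∀ s : S, Φ (comul s) = Ψ (comul s)
  /-- `δ(S)(1 ⊗ S) ⊆ S ⊗ S`. -/
  comul_mul_oneTmul : ∀ s t : S, ∃ x : MinTensor π π,
    comul s * oneTmul π π t = (x : 𝓜(ℂ, MinTensor π π))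
  /-- `δ(S)(S ⊗ 1) ⊆ S ⊗ S`. -/
  comul_mul_tmulOne : ∀ s t : S, ∃ x : MinTensor π π,
    comul s * tmulOne π π t = (x : 𝓜(ℂ, MinTensor π π))

namespace HopfCStarAlgebra

variable {π : FaithfulRep S H} (𝓗 : HopfCStarAlgebra π)

/-- `S` is saturated: the linear spans of `δ(S)(1 ⊗ S)` and of `δ(S)(S ⊗ 1)` are dense in
`S ⊗ S`. -/
structure IsSaturated : Prop where
  dense_oneTmul : Dense (Submodule.span ℂ {x : MinTensor π π | ∃ s t : S,
    𝓗.comul s * oneTmul π π t = (x : 𝓜(ℂ, MinTensor π π))} : Set (MinTensor π π))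
  dense_tmulOne : Dense (Submodule.span ℂ {x : MinTensor π π | ∃ s t : S,
    𝓗.comul s * tmulOne π π t = (x : 𝓜(ℂ, MinTensor π π))} : Set (MinTensor π π))

/-- The comultiplication as a continuous linear map. -/
def comulL : S →L[ℂ] 𝓜(ℂ, MinTensor π π) :=
  LinearMap.mkContinuous (𝓗.comul : S →ₗ[ℂ] 𝓜(ℂ, MinTensor π π)) 1 fun s => by
    rw [one_mul]; exact NonUnitalStarAlgHom.norm_apply_le 𝓗.comul s

theorem norm_comulL_le : ‖𝓗.comulL‖ ≤ 1 := LinearMap.mkContinuous_norm_le _ zero_le_one _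

/-- The product `f g = (f ⊗ g) ∘ δ` of the Banach algebra `S*`, where `f ⊗ g` is extended to
`M(S ⊗ S)` by strict continuity. -/
def conv : (S →L[ℂ] ℂ) →L[ℂ] (S →L[ℂ] ℂ) →L[ℂ] (S →L[ℂ] ℂ) :=
  LinearMap.mkContinuous₂
    (LinearMap.mk₂ ℂ (fun f g => strictExtension (tensorFunctional π π f g) ∘L 𝓗.comulL)
      (fun f f' g => by
        rw [tensorFunctional_add_left, strictExtension_add, ContinuousLinearMap.add_comp])
      (fun c f g => by
        rw [tensorFunctional_smul_left, strictExtension_smul, ContinuousLinearMap.smul_comp])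
      (fun f g g' => by
        rw [tensorFunctional_add_right, strictExtension_add, ContinuousLinearMap.add_comp])
      (fun c f g => by
        rw [tensorFunctional_smul_right, strictExtension_smul, ContinuousLinearMap.smul_comp]))
    1 fun f g => by
      calc ‖strictExtension (tensorFunctional π π f g) ∘L 𝓗.comulL‖
          ≤ ‖strictExtension (tensorFunctional π π f g)‖ * ‖𝓗.comulL‖ :=
            ContinuousLinearMap.opNorm_comp_le _ _
        _ ≤ (‖f‖ * ‖g‖) * 1 := by
            gcongr
            · exact (norm_strictExtension_le _).trans (norm_tensorFunctional_le π π f g)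
            · exact 𝓗.norm_comulL_le
        _ = 1 * ‖f‖ * ‖g‖ := by ring

theorem conv_apply (f g : S →L[ℂ] ℂ) (s : S) :
    𝓗.conv f g s = strictExtension (tensorFunctional π π f g) (𝓗.comul s) := rfl

/-- A subspace of `S*` is `S`-invariant if it is stable under `f ↦ s · f = f (· s)` and
`f ↦ f · s = f (s ·)` for all `s ∈ S`. -/
def IsInvariant (A : Submodule ℂ (S →L[ℂ] ℂ)) : Prop :=
  ∀ f ∈ A, ∀ s : S, f ∘L (ContinuousLinearMap.mul ℂ S).flip s ∈ A ∧
    f ∘L ContinuousLinearMap.mul ℂ S s ∈ A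

/-- A left Hopf ideal: a non-zero norm-closed `S`-invariant left ideal of `S*`. -/
structure IsLeftHopfIdeal (A : Submodule ℂ (S →L[ℂ] ℂ)) : Prop where
  ne_bot : A ≠ ⊥
  isClosed : IsClosed (A : Set (S →L[ℂ] ℂ))
  invariant : IsInvariant A
  mul_mem : ∀ h : S →L[ℂ] ℂ, ∀ f ∈ A, 𝓗.conv h f ∈ A

/-- A right Hopf ideal: a non-zero norm-closed `S`-invariant right ideal of `S*`. -/
structure IsRightHopfIdeal (A : Submodule ℂ (S →L[ℂ] ℂ)) : Prop where
  ne_bot : A ≠ ⊥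
  isClosed : IsClosed (A : Set (S →L[ℂ] ℂ))
  invariant : IsInvariant A
  mul_mem : ∀ h : S →L[ℂ] ℂ, ∀ f ∈ A, 𝓗.conv f h ∈ A

/-- A 2-sided Hopf ideal: a non-zero norm-closed `S`-invariant 2-sided ideal of `S*`. -/
structure IsHopfIdeal (A : Submodule ℂ (S →L[ℂ] ℂ)) : Prop where
  ne_bot : A ≠ ⊥
  isClosed : IsClosed (A : Set (S →L[ℂ] ℂ))
  invariant : IsInvariant A
  mul_mem_left : ∀ h : S →L[ℂ] ℂ, ∀ f ∈ A, 𝓗.conv h f ∈ A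
  mul_mem_right : ∀ h : S →L[ℂ] ℂ, ∀ f ∈ A, 𝓗.conv f h ∈ A

/-- The left Fourier algebra: the intersection of all left Hopf ideals. -/
def leftFourier : Submodule ℂ (S →L[ℂ] ℂ) := sInf {A | 𝓗.IsLeftHopfIdeal A}

/-- The right Fourier algebra: the intersection of all right Hopf ideals. -/
def rightFourier : Submodule ℂ (S →L[ℂ] ℂ) := sInf {A | 𝓗.IsRightHopfIdeal A}

/-- The Fourier algebra: the intersection of all 2-sided Hopf ideals. -/
def fourier : Submodule ℂ (S →L[ℂ] ℂ) := sInf {A | 𝓗.IsHopfIdeal A}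

theorem conv_mem_leftFourier (h : S →L[ℂ] ℂ) {a : S →L[ℂ] ℂ} (ha : a ∈ 𝓗.leftFourier) :
    𝓗.conv h a ∈ 𝓗.leftFourier := by
  rw [leftFourier, Submodule.mem_sInf] at ha ⊢
  exact fun A hA => IsLeftHopfIdeal.mul_mem hA h a (ha A hA)

theorem conv_mem_rightFourier (h : S →L[ℂ] ℂ) {a : S →L[ℂ] ℂ} (ha : a ∈ 𝓗.rightFourier) :
    𝓗.conv a h ∈ 𝓗.rightFourier := by
  rw [rightFourier, Submodule.mem_sInf] at ha ⊢
  exact fun A hA => IsRightHopfIdeal.mul_mem hA h a (ha A hA)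

theorem conv_mem_fourier_left (h : S →L[ℂ] ℂ) {a : S →L[ℂ] ℂ} (ha : a ∈ 𝓗.fourier) :
    𝓗.conv h a ∈ 𝓗.fourier := by
  rw [fourier, Submodule.mem_sInf] at ha ⊢
  exact fun A hA => IsHopfIdeal.mul_mem_left hA h a (ha A hA)

theorem conv_mem_fourier_right (h : S →L[ℂ] ℂ) {a : S →L[ℂ] ℂ} (ha : a ∈ 𝓗.fourier) :
    𝓗.conv a h ∈ 𝓗.fourier := by
  rw [fourier, Submodule.mem_sInf] at ha ⊢
  exact fun A hA => IsHopfIdeal.mul_mem_right hA h a (ha A hA)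

/-- `A` has a bounded left approximate identity: a norm-bounded net `(e_i)` in `A`, given by the
filter that it generates, with `e_i a → a` in norm for all `a ∈ A`. -/
def HasLeftBAI (A : Submodule ℂ (S →L[ℂ] ℂ)) : Prop :=
  ∃ (l : Filter A) (C : ℝ), l.NeBot ∧ (∀ᶠ e in l, ‖e‖ ≤ C) ∧
    ∀ a : A, Tendsto (fun e : A => 𝓗.conv e a) l (𝓝 (a : S →L[ℂ] ℂ))

/-- `A` has a bounded right approximate identity. -/
def HasRightBAI (A : Submodule ℂ (S →L[ℂ] ℂ)) : Prop :=
  ∃ (l : Filter A) (C : ℝ), l.NeBot ∧ (∀ᶠ e in l, ‖e‖ ≤ C) ∧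
    ∀ a : A, Tendsto (fun e : A => 𝓗.conv a e) l (𝓝 (a : S →L[ℂ] ℂ))

/-- `A` has a bounded 2-sided approximate identity. -/
def HasBAI (A : Submodule ℂ (S →L[ℂ] ℂ)) : Prop :=
  ∃ (l : Filter A) (C : ℝ), l.NeBot ∧ (∀ᶠ e in l, ‖e‖ ≤ C) ∧
    ∀ a : A, Tendsto (fun e : A => 𝓗.conv e a) l (𝓝 (a : S →L[ℂ] ℂ)) ∧
      Tendsto (fun e : A => 𝓗.conv a e) l (𝓝 (a : S →L[ℂ] ℂ))

/-- `S*` is a unital algebra. -/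
def DualUnital : Prop :=
  ∃ u : S →L[ℂ] ℂ, ∀ f : S →L[ℂ] ℂ, 𝓗.conv u f = f ∧ 𝓗.conv f u = f

/-- `A` separates the points of `S`. -/
def SeparatesPoints (A : Submodule ℂ (S →L[ℂ] ℂ)) : Prop :=
  ∀ s t : S, s ≠ t → ∃ f ∈ A, f s ≠ f t

/-- Left multipliers of a subspace `A` of `S*`: bounded operators `l` on `A` with
`l (a b) = l (a) b`. -/
def leftMultipliers (A : Submodule ℂ (S →L[ℂ] ℂ)) : Set (A →L[ℂ] A) :=
  {l | ∀ (a b : A) (hab : 𝓗.conv a b ∈ A),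
    (l ⟨𝓗.conv a b, hab⟩ : S →L[ℂ] ℂ) = 𝓗.conv (l a) b}

/-- Right multipliers of `A`: bounded operators `r` on `A` with `r (a b) = a r (b)`. -/
def rightMultipliers (A : Submodule ℂ (S →L[ℂ] ℂ)) : Set (A →L[ℂ] A) :=
  {r | ∀ (a b : A) (hab : 𝓗.conv a b ∈ A),
    (r ⟨𝓗.conv a b, hab⟩ : S →L[ℂ] ℂ) = 𝓗.conv a (r b)}

/-- Multipliers of `A`: pairs `(l, r)` of a left and a right multiplier with
`a l (b) = r (a) b`. -/
def multipliers (A : Submodule ℂ (S →L[ℂ] ℂ)) : Set ((A →L[ℂ] A) × (A →L[ℂ] A)) :=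
  {m | m.1 ∈ 𝓗.leftMultipliers A ∧ m.2 ∈ 𝓗.rightMultipliers A ∧
    ∀ a b : A, 𝓗.conv a (m.1 b) = 𝓗.conv (m.2 a) b}

/-- The canonical map `h ↦ (a ↦ h a)` from `S*` to the operators on the left Fourier algebra. -/
def toLeftMultiplier (h : S →L[ℂ] ℂ) : 𝓗.leftFourier →L[ℂ] 𝓗.leftFourier :=
  (𝓗.conv h ∘L 𝓗.leftFourier.subtypeL).codRestrict 𝓗.leftFourier
    fun a => 𝓗.conv_mem_leftFourier h a.2

/-- The canonical map `h ↦ (a ↦ a h)` from `S*` to the operators on the right Fourier algebra. -/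
def toRightMultiplier (h : S →L[ℂ] ℂ) : 𝓗.rightFourier →L[ℂ] 𝓗.rightFourier :=
  (𝓗.conv.flip h ∘L 𝓗.rightFourier.subtypeL).codRestrict 𝓗.rightFourier
    fun a => 𝓗.conv_mem_rightFourier h a.2

/-- The canonical map `h ↦ (a ↦ h a, a ↦ a h)` from `S*` to the pairs of operators on the Fourier
algebra. -/
def toMultiplier (h : S →L[ℂ] ℂ) :
    (𝓗.fourier →L[ℂ] 𝓗.fourier) × (𝓗.fourier →L[ℂ] 𝓗.fourier) :=
  ((𝓗.conv h ∘L 𝓗.fourier.subtypeL).codRestrict 𝓗.fourier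
      fun a => 𝓗.conv_mem_fourier_left h a.2,
    (𝓗.conv.flip h ∘L 𝓗.fourier.subtypeL).codRestrict 𝓗.fourier
      fun a => 𝓗.conv_mem_fourier_right h a.2)

/-- Left `H₁`-coamenability. -/
def LeftH1 : Prop := 𝓗.leftFourier ≠ ⊥ ∧ 𝓗.HasLeftBAI 𝓗.leftFourier

/-- Right `H₁`-coamenability. -/
def RightH1 : Prop := 𝓗.rightFourier ≠ ⊥ ∧ 𝓗.HasRightBAI 𝓗.rightFourier

/-- 2-sided `H₁`-coamenability. -/
def TwoSidedH1 : Prop := 𝓗.fourier ≠ ⊥ ∧ 𝓗.HasBAI 𝓗.fourier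

/-- Left `H₂`-coamenability. -/
def LeftH2 : Prop := 𝓗.DualUnital ∧ ∀ A, 𝓗.IsLeftHopfIdeal A → SeparatesPoints A

/-- Right `H₂`-coamenability. -/
def RightH2 : Prop := 𝓗.DualUnital ∧ ∀ A, 𝓗.IsRightHopfIdeal A → SeparatesPoints A

/-- 2-sided `H₂`-coamenability. -/
def TwoSidedH2 : Prop := 𝓗.DualUnital ∧ ∀ A, 𝓗.IsHopfIdeal A → SeparatesPoints A

/-- Left `H₃`-coamenability: the canonical map maps `S*` onto the left multipliers of the left
Fourier algebra. -/
def LeftH3 : Prop := Set.range 𝓗.toLeftMultiplier = 𝓗.leftMultipliers 𝓗.leftFourier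

/-- Right `H₃`-coamenability: the canonical map maps `S*` onto the right multipliers of the right
Fourier algebra. -/
def RightH3 : Prop := Set.range 𝓗.toRightMultiplier = 𝓗.rightMultipliers 𝓗.rightFourier

/-- 2-sided `H₃`-coamenability: the canonical map maps `S*` onto the multipliers of the Fourier
algebra. -/
def TwoSidedH3 : Prop := Set.range 𝓗.toMultiplier = 𝓗.multipliers 𝓗.fourier

end HopfCStarAlgebra

end HopfAlgebra

end HopfCStar

end

/-!
Three facts about the product of the Banach algebra `S*` carry the theorem.

* It is associative (`conv_assoc`). Every functional is a norm limit of translates `F (· x)`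
  (`exists_norm_sub_translate_le`), and the strict extension of a translate is the explicit
  functional `m ↦ F (m x)`. So it suffices to compare both sides on translates. Non-degeneracy of
  `δ ⊗ id` and `id ⊗ δ` makes these compatible with strict extensions
  (`strictExtension_pullback`), which turns coassociativity into associativity.
* It is separately weak*-continuous (`exists_conv_eq_left`, `exists_conv_eq_right`): as `δ(S)(S ⊗ 1)`
  and `δ(S)(1 ⊗ S)` lie in `S ⊗ S`, the slices of `δ(s)` by a functional lie in `S`.
* A non-zero invariant subspace `A` has no left and no right annihilator in `S*`
  (`IsSaturated.eq_zero_of_conv_left`, `IsSaturated.eq_zero_of_conv_right`), because `h a = 0` for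
  all `a ∈ A` means that `h ⊗ a` vanishes on `δ(S)(1 ⊗ S)`, which spans a dense subspace of `S ⊗ S`.
  This also gives the injectivity of the maps to multipliers.

Suppose that the left ideal `A` has a bounded left approximate identity `(e)`. A weak* cluster point
`u` of it satisfies `u a = a` for `a ∈ A`; then `(u h - h) a = 0` and `(h u - h) a = 0`, so `u` is a
unit of `S*`. Each `h = h u` is a weak* limit of the elements `h e` of `A`, so `A` separates the
points of `S`. A left multiplier `l` is multiplication by a weak* cluster point of `l(e)`, since
`l(e) a = l(e a)` tends to `l(a)`. The right-handed arguments are mirror images.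

If `S*` has a unit `u` and the Fourier algebra `A` separates the points of `S`, there need be no
bounded approximate identity, but `u` is still a weak* limit of a bounded net `(e)` in `A`, because
`S → A*` is isometric (`norm_flip_eq`). This is an instance of the minimality of the C⋆-norm
(`norm_eq_of_submultiplicative`), applied to the action of `S` on `A`. For a multiplier `(l, r)` and
a weak* cluster point `h` of `l(e)`, the identity `b l(e) = r(b) e` yields `b h = r(b) u = r(b)`, and
from `b l(a) = r(b) a = b h a` it follows that `l(a) = h a`.

Weak* limits of nets in `A` are encoded by elements `U` of the double dual of `A`: the limit of
`T e` is the functional `weakLimit U T`.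
-/

noncomputable section

namespace HopfCStar

/-! ### Translates of functionals -/

section Translates

variable {A : Type*} [NonUnitalCStarAlgebra A]

/-- The translate `F (· x)` of the functional `F`. -/
def translate (F : A →L[ℂ] ℂ) (x : A) : A →L[ℂ] ℂ :=
  F ∘L (ContinuousLinearMap.mul ℂ A).flip x

theorem translate_apply (F : A →L[ℂ] ℂ) (x a : A) : translate F x a = F (a * x) := rfl

/-- Translates of `F` approximate `F` in norm. -/
theorem exists_norm_sub_translate_le (F : A →L[ℂ] ℂ) {ε : ℝ} (hε : 0 < ε) :
    ∃ x : A, ‖F - translate F x‖ ≤ ε := by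
  obtain ⟨e, he⟩ := exists_small F (strictExtension F) (norm_strictExtension_le F)
    (isStrictExtension F).extends_coe ε hε
  refine ⟨e, ContinuousLinearMap.opNorm_le_of_unit_norm hε.le fun a ha => ?_⟩
  have h := he a (by rw [norm_coe, ha])
  rw [(isStrictExtension F).extends_coe] at h
  exact h

/-- A closed subspace contains all values of a bounded operator on `A*` as soon as it contains
its values at translates. -/
theorem apply_mem_of_translate {E : Type*} [NormedAddCommGroup E] [NormedSpace ℂ E]
    (P : Submodule ℂ E) (hP : IsClosed (P : Set E)) (u : (A →L[ℂ] ℂ) →L[ℂ] E)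
    (h : ∀ F x, u (translate F x) ∈ P) (F : A →L[ℂ] ℂ) : u F ∈ P := by
  have hc : IsClosed {F | u F ∈ P} := hP.preimage u.continuous
  refine hc.closure_subset (Metric.mem_closure_iff.2 fun ε hε => ?_)
  obtain ⟨x, hx⟩ := exists_norm_sub_translate_le F (half_pos hε)
  exact ⟨translate F x, h F x, by rw [dist_eq_norm]; linarith⟩

theorem clm_ext_translate {E : Type*} [NormedAddCommGroup E] [NormedSpace ℂ E]
    {u v : (A →L[ℂ] ℂ) →L[ℂ] E} (h : ∀ F x, u (translate F x) = v (translate F x)) : u = v := by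
  ext1 F
  have := apply_mem_of_translate (⊥ : Submodule ℂ E) isClosed_singleton (u - v)
    (fun F x => by simp [h F x]) F
  simpa [sub_eq_zero] using this

end Translates

/-! ### Strict extensions -/

section Strict

variable {A : Type*} [NonUnitalCStarAlgebra A]

theorem snd_mul (m : 𝓜(ℂ, A)) (a b : A) : m.snd (a * b) = a * m.snd b :=
  mul_right_faithful fun y => by
    rw [m.central, mul_assoc, mul_assoc, m.central]

theorem coe_mul (a : A) (m : 𝓜(ℂ, A)) : (a : 𝓜(ℂ, A)) * m = ((m.snd a : A) : 𝓜(ℂ, A)) := by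
  apply DoubleCentralizer.ext
  refine Prod.ext (ContinuousLinearMap.ext fun x => ?_) (ContinuousLinearMap.ext fun x => ?_)
  · exact (m.central a x).symm
  · exact snd_mul m x a

/-- `G (· t)` is the strict extension of `F (· t)`. -/
theorem IsStrictExtension.comp_mul_right {F : A →L[ℂ] ℂ} {G : 𝓜(ℂ, A) →L[ℂ] ℂ}
    (h : IsStrictExtension F G) (t : 𝓜(ℂ, A)) :
    IsStrictExtension (F ∘L t.snd) (G ∘L (ContinuousLinearMap.mul ℂ 𝓜(ℂ, A)).flip t) where
  extends_coe a := by
    change G ((a : 𝓜(ℂ, A)) * t) = F (t.snd a)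
    rw [coe_mul, h.extends_coe]
  strict R ε hε := by
    classical
    obtain ⟨X, d, hd, hX⟩ := h.strict (R * ‖t‖) ε hε
    refine ⟨X ∪ X.image t.fst, d / (‖t‖ + 1), by positivity, fun m hm hmX =>
      hX (m * t) ((norm_mul_le _ _).trans (by gcongr)) fun x hx => ⟨?_, ?_⟩⟩
    · have h1 := (hmX (t.fst x) (Finset.mem_union_right _ (Finset.mem_image_of_mem _ hx))).1
      refine lt_of_lt_of_le h1 (div_le_self hd.le ?_)
      linarith [norm_nonneg t]
    · have h1 := (hmX x (Finset.mem_union_left _ hx)).2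
      rw [lt_div_iff₀ (by positivity)] at h1
      calc ‖(m * t).snd x‖ = ‖t.snd (m.snd x)‖ := rfl
        _ ≤ ‖t‖ * ‖m.snd x‖ := by
            rw [← DoubleCentralizer.norm_snd t]; exact t.snd.le_opNorm _
        _ ≤ ‖m.snd x‖ * (‖t‖ + 1) := by nlinarith [norm_nonneg (m.snd x)]
        _ < d := h1

theorem strictExtension_comp_snd (F : A →L[ℂ] ℂ) (t m : 𝓜(ℂ, A)) :
    strictExtension (F ∘L t.snd) m = strictExtension F (m * t) :=
  DFunLike.congr_fun
    ((isStrictExtension _).unique ((isStrictExtension F).comp_mul_right t)) m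

theorem strictExtension_coe (F : A →L[ℂ] ℂ) (a : A) :
    strictExtension F (a : 𝓜(ℂ, A)) = F a :=
  (isStrictExtension F).extends_coe a

/-- On translates the strict extension is given by a formula that avoids limits. -/
theorem strictExtension_translate (F : A →L[ℂ] ℂ) (x : A) (m : 𝓜(ℂ, A)) :
    strictExtension (translate F x) m = F (m.fst x) := by
  have h := strictExtension_comp_snd F (x : 𝓜(ℂ, A)) m
  rw [mul_coe, strictExtension_coe] at h
  exact h

variable (A) in
/-- `strictExtension` as a bounded operator. -/
def strictExtensionL : (A →L[ℂ] ℂ) →L[ℂ] (𝓜(ℂ, A) →L[ℂ] ℂ) :=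
  LinearMap.mkContinuous
    { toFun := strictExtension
      map_add' := strictExtension_add
      map_smul' := strictExtension_smul } 1 fun F => by
    rw [one_mul]; exact norm_strictExtension_le F

variable (A) in
/-- The inclusion of `A` in its multiplier algebra, as a bounded operator. -/
def coeL : A →L[ℂ] 𝓜(ℂ, A) :=
  LinearMap.mkContinuous (DoubleCentralizer.coeHom (𝕜 := ℂ) (A := A) : A →ₗ[ℂ] 𝓜(ℂ, A)) 1
    fun a => by rw [one_mul]; exact (norm_coe a).le

theorem coeL_apply (a : A) : coeL A a = (a : 𝓜(ℂ, A)) := rfl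

end Strict

/-! ### Tensor products of functionals and slice maps -/

section Slices

variable {A B H K : Type*} [NonUnitalCStarAlgebra A] [NonUnitalCStarAlgebra B]
  [NormedAddCommGroup H] [InnerProductSpace ℂ H] [CompleteSpace H]
  [NormedAddCommGroup K] [InnerProductSpace ℂ K] [CompleteSpace K]
  (π : FaithfulRep A H) (ρ : FaithfulRep B K)

/-- `(f, g) ↦ f ⊗ g` as a bounded bilinear map. -/
def tensorFunctionalL :
    (A →L[ℂ] ℂ) →L[ℂ] (B →L[ℂ] ℂ) →L[ℂ] (MinTensor π ρ →L[ℂ] ℂ) :=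
  LinearMap.mkContinuous₂
    (LinearMap.mk₂ ℂ (tensorFunctional π ρ) (tensorFunctional_add_left π ρ)
      (tensorFunctional_smul_left π ρ) (tensorFunctional_add_right π ρ)
      (tensorFunctional_smul_right π ρ))
    1 fun f g => by rw [one_mul]; exact norm_tensorFunctional_le π ρ f g

theorem translate_tensorFunctional (f : A →L[ℂ] ℂ) (g : B →L[ℂ] ℂ) (x : A) (y : B) :
    translate (tensorFunctional π ρ f g) (tmul π ρ x y) =
      tensorFunctional π ρ (translate f x) (translate g y) :=
  clm_ext_tmul π ρ fun a b => by
    rw [translate_apply, tmul_mul, tensorFunctional_tmul, tensorFunctional_tmul]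
    rfl

/-- The canonical image of `E` in its double dual: the functionals on `E*` given by evaluation at
an element of `E`. -/
def evaluations (E : Type*) [NormedAddCommGroup E] [NormedSpace ℂ E] :
    Submodule ℂ ((E →L[ℂ] ℂ) →L[ℂ] ℂ) where
  carrier := {φ | ∃ x, ∀ g, φ g = g x}
  add_mem' := by
    rintro φ ψ ⟨x, hx⟩ ⟨y, hy⟩
    exact ⟨x + y, fun g => by rw [add_apply, hx, hy, map_add]⟩
  zero_mem' := ⟨0, fun g => by rw [zero_apply, map_zero]⟩
  smul_mem' := by
    rintro c φ ⟨x, hx⟩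
    exact ⟨c • x, fun g => by rw [smul_apply, hx, map_smul]⟩

theorem isClosed_evaluations (E : Type*) [NormedAddCommGroup E] [NormedSpace ℂ E]
    [CompleteSpace E] : IsClosed (evaluations E : Set ((E →L[ℂ] ℂ) →L[ℂ] ℂ)) := by
  have h : IsClosed (Set.range (NormedSpace.inclusionInDoubleDualLi ℂ (E := E))) :=
    Isometry.isClosedEmbedding (γ := StrongDual ℂ (StrongDual ℂ E))
      (NormedSpace.inclusionInDoubleDualLi ℂ (E := E)).isometry |>.isClosed_range
  convert h using 1
  ext φ
  exact ⟨fun ⟨x, hx⟩ => ⟨x, ContinuousLinearMap.ext fun g => (hx g).symm⟩,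
    fun ⟨x, hx⟩ => ⟨x, fun g => (DFunLike.congr_fun hx g).symm⟩⟩

/-- The slice map `f ⊗ id`: the value `(f ⊗ g) (y)` is, as a functional of `g`, the evaluation at
an element of `B`. -/
theorem exists_slice_left (f : A →L[ℂ] ℂ) (y : MinTensor π ρ) :
    ∃ b : B, ∀ g : B →L[ℂ] ℂ, tensorFunctional π ρ f g y = g b := by
  have h : ∀ a b, (tensorFunctionalL π ρ f).flip (tmul π ρ a b) ∈ evaluations B := fun a b =>
    ⟨f a • b, fun g => by
      change tensorFunctional π ρ f g (tmul π ρ a b) = g (f a • b)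
      rw [tensorFunctional_tmul, map_smul, smul_eq_mul]⟩
  exact minTensor_induction π ρ (E := (B →L[ℂ] ℂ) →L[ℂ] ℂ) (evaluations B)
    (isClosed_evaluations B)
    (tensorFunctionalL π ρ f).flip h y

/-- The slice map `id ⊗ g`. -/
theorem exists_slice_right (g : B →L[ℂ] ℂ) (y : MinTensor π ρ) :
    ∃ a : A, ∀ f : A →L[ℂ] ℂ, tensorFunctional π ρ f g y = f a := by
  have h : ∀ a b, ((tensorFunctionalL π ρ).flip g).flip (tmul π ρ a b) ∈ evaluations A :=
    fun a b => ⟨g b • a, fun f => by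
      change tensorFunctional π ρ f g (tmul π ρ a b) = f (g b • a)
      rw [tensorFunctional_tmul, map_smul, smul_eq_mul, mul_comm]⟩
  exact minTensor_induction π ρ (E := (A →L[ℂ] ℂ) →L[ℂ] ℂ) (evaluations A)
    (isClosed_evaluations A)
    ((tensorFunctionalL π ρ).flip g).flip h y

theorem oneTmul_snd_tmul (b b' : B) (a : A) :
    (oneTmul π ρ b).snd (tmul π ρ a b') = tmul π ρ a (b' * b) :=
  (π.tensor ρ).injective (by
    change opTensor (π.toHom a) (ρ.toHom b') * opTensor 1 (ρ.toHom b) =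
      opTensor (π.toHom a) (ρ.toHom (b' * b))
    rw [opTensor_mul, mul_one, ← map_mul])

theorem tmulOne_snd_tmul (a a' : A) (b : B) :
    (tmulOne π ρ a).snd (tmul π ρ a' b) = tmul π ρ (a' * a) b :=
  (π.tensor ρ).injective (by
    change opTensor (π.toHom a') (ρ.toHom b) * opTensor (π.toHom a) 1 =
      opTensor (π.toHom (a' * a)) (ρ.toHom b)
    rw [opTensor_mul, mul_one, ← map_mul])

theorem tensorFunctional_translate_left (f : A →L[ℂ] ℂ) (g : B →L[ℂ] ℂ) (x : A) :
    tensorFunctional π ρ (translate f x) g =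
      tensorFunctional π ρ f g ∘L (tmulOne π ρ x).snd :=
  clm_ext_tmul π ρ fun a b => by
    rw [ContinuousLinearMap.comp_apply, tmulOne_snd_tmul, tensorFunctional_tmul,
      tensorFunctional_tmul, translate_apply]

theorem tensorFunctional_translate_right (f : A →L[ℂ] ℂ) (g : B →L[ℂ] ℂ) (y : B) :
    tensorFunctional π ρ f (translate g y) =
      tensorFunctional π ρ f g ∘L (oneTmul π ρ y).snd :=
  clm_ext_tmul π ρ fun a b => by
    rw [ContinuousLinearMap.comp_apply, oneTmul_snd_tmul, tensorFunctional_tmul,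
      tensorFunctional_tmul, translate_apply]

end Slices

/-! ### Pulling back functionals along non-degenerate homomorphisms of multiplier algebras -/

section Pullback

variable {A B : Type*} [NonUnitalCStarAlgebra A] [NonUnitalCStarAlgebra B]

/-- `x ↦ F (· x)` as a bounded operator. -/
def translateL (F : A →L[ℂ] ℂ) : A →L[ℂ] (A →L[ℂ] ℂ) :=
  ContinuousLinearMap.compL ℂ A A ℂ F ∘L (ContinuousLinearMap.mul ℂ A).flip

/-- A `*`-homomorphism of multiplier algebras as a bounded operator. -/
def homL (Φ : 𝓜(ℂ, A) →⋆ₐ[ℂ] 𝓜(ℂ, B)) : 𝓜(ℂ, A) →L[ℂ] 𝓜(ℂ, B) :=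
  LinearMap.mkContinuous (Φ : 𝓜(ℂ, A) →ₗ[ℂ] 𝓜(ℂ, B)) 1 fun m => by
    rw [one_mul]; exact NonUnitalStarAlgHom.norm_apply_le Φ m

/-- The functional `P ∘ Φ` on `A`, where `P` is extended to `𝓜(ℂ, B)` by strict continuity; as a
bounded operator in `P`. -/
def pullback (Φ : 𝓜(ℂ, A) →⋆ₐ[ℂ] 𝓜(ℂ, B)) : (B →L[ℂ] ℂ) →L[ℂ] (A →L[ℂ] ℂ) :=
  (ContinuousLinearMap.compL ℂ A 𝓜(ℂ, B) ℂ).flip (homL Φ ∘L coeL A) ∘L strictExtensionL B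

theorem pullback_apply (Φ : 𝓜(ℂ, A) →⋆ₐ[ℂ] 𝓜(ℂ, B)) (P : B →L[ℂ] ℂ) (a : A) :
    pullback Φ P a = strictExtension P (Φ (a : 𝓜(ℂ, A))) := rfl

/-- A homomorphism `Φ` of multiplier algebras for which `Φ(A) B` spans a dense subspace of `B` is
strictly continuous, in the form that it commutes with strict extensions of functionals. By density
it is enough to consider `P (· Φ(y) z)`, whose pullback is a translate by `y`. -/
theorem strictExtension_pullback (Φ : 𝓜(ℂ, A) →⋆ₐ[ℂ] 𝓜(ℂ, B))
    (hΦ : Dense (Submodule.span ℂ {b : B | ∃ (y : A) (z : B), b = (Φ (y : 𝓜(ℂ, A))).fst z} : Set B))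
    (P : B →L[ℂ] ℂ) (m : 𝓜(ℂ, A)) :
    strictExtension (pullback Φ P) m = strictExtension P (Φ m) := by
  let ev₁ : (A →L[ℂ] ℂ) →L[ℂ] ℂ := (strictExtensionL A).flip m
  let ev₂ : (B →L[ℂ] ℂ) →L[ℂ] ℂ := (strictExtensionL B).flip (Φ m)
  suffices h : ev₁ ∘L pullback Φ = ev₂ from DFunLike.congr_fun h P
  refine clm_ext_translate fun P x => ?_
  suffices h : ev₁ ∘L pullback Φ ∘L translateL P = ev₂ ∘L translateL P from
    DFunLike.congr_fun h x
  refine ContinuousLinearMap.ext_on hΦ ?_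
  rintro _ ⟨y, z, rfl⟩
  change strictExtension (pullback Φ (translate P _)) m = strictExtension (translate P _) (Φ m)
  have h : pullback Φ (translate P ((Φ (y : 𝓜(ℂ, A))).fst z)) =
      translate (pullback Φ (translate P z)) y := by
    ext w
    rw [translate_apply, pullback_apply, pullback_apply, strictExtension_translate,
      strictExtension_translate, ← coeL_apply (w * y)]
    have : coeL A (w * y) = (w : 𝓜(ℂ, A)) * (y : 𝓜(ℂ, A)) :=
      map_mul (DoubleCentralizer.coeHom (𝕜 := ℂ) (A := A)) w y
    rw [this, map_mul]
    rfl
  rw [h, strictExtension_translate, strictExtension_translate, pullback_apply,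
    strictExtension_translate, ← mul_coe, map_mul]
  rfl

end Pullback

/-! ### Elementary tensors as bounded bilinear maps -/

section OpAssoc

variable {H₁ H₂ H₃ : Type*} [NormedAddCommGroup H₁] [InnerProductSpace ℂ H₁]
  [NormedAddCommGroup H₂] [InnerProductSpace ℂ H₂]
  [NormedAddCommGroup H₃] [InnerProductSpace ℂ H₃]

theorem norm_opAssoc_le (a : H₁ →L[ℂ] H₁) (x : HTensor H₂ H₃ →L[ℂ] HTensor H₂ H₃) :
    ‖opAssoc a x‖ ≤ ‖a‖ * ‖x‖ :=
  ContinuousLinearMap.opNorm_le_bound _ (by positivity) fun v => by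
    change ‖hassoc.symm (opTensor a x (hassoc v))‖ ≤ _
    rw [LinearIsometryEquiv.norm_map]
    calc _ ≤ ‖opTensor a x‖ * ‖hassoc v‖ := ContinuousLinearMap.le_opNorm _ _
      _ ≤ _ := by
        rw [LinearIsometryEquiv.norm_map]
        gcongr
        exact norm_opTensor_le a x

end OpAssoc

section Triple

variable {A B C H₁ H₂ H₃ : Type*} [NonUnitalCStarAlgebra A] [NonUnitalCStarAlgebra B]
  [NonUnitalCStarAlgebra C]
  [NormedAddCommGroup H₁] [InnerProductSpace ℂ H₁] [CompleteSpace H₁]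
  [NormedAddCommGroup H₂] [InnerProductSpace ℂ H₂] [CompleteSpace H₂]
  [NormedAddCommGroup H₃] [InnerProductSpace ℂ H₃] [CompleteSpace H₃]
  (π : FaithfulRep A H₁) (ρ : FaithfulRep B H₂) (σ : FaithfulRep C H₃)

theorem norm_tmul_le (a : A) (b : B) : ‖tmul π ρ a b‖ ≤ ‖a‖ * ‖b‖ := by
  rw [← (π.tensor ρ).norm_map, tensor_tmul, ← π.norm_map a, ← ρ.norm_map b]
  exact norm_opTensor_le _ _

/-- `(a, b) ↦ a ⊗ b` as a bounded bilinear map. -/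
def tmulL : A →L[ℂ] B →L[ℂ] MinTensor π ρ :=
  LinearMap.mkContinuous₂
    (LinearMap.mk₂ ℂ (tmul π ρ)
      (fun a a' b => (π.tensor ρ).injective
        (by simp only [tensor_tmul, map_add, opTensor_add_left]))
      (fun c a b => (π.tensor ρ).injective
        (by simp only [tensor_tmul, map_smul, opTensor_smul_left]))
      (fun a b b' => (π.tensor ρ).injective
        (by simp only [tensor_tmul, map_add, opTensor_add_right]))
      (fun c a b => (π.tensor ρ).injective
        (by simp only [tensor_tmul, map_smul, opTensor_smul_right])))
    1 fun a b => by rw [one_mul]; exact norm_tmul_le π ρ a b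

theorem toHom_tmulAssoc (a : A) (x : MinTensor ρ σ) :
    ((π.tensor ρ).tensor σ).toHom (tmulAssoc π ρ σ a x) =
      opAssoc (π.toHom a) ((ρ.tensor σ).toHom x) := rfl

/-- `(a, x) ↦ a ⊗ x`, for `x ∈ B ⊗ C`, as a bounded bilinear map. -/
def tmulAssocL : A →L[ℂ] MinTensor ρ σ →L[ℂ] MinTensor (π.tensor ρ) σ :=
  LinearMap.mkContinuous₂
    (LinearMap.mk₂ ℂ (tmulAssoc π ρ σ)
      (fun a a' x => ((π.tensor ρ).tensor σ).injective
        (by simp only [toHom_tmulAssoc, map_add, opAssoc, opTensor_add_left,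
          ContinuousLinearMap.add_comp, ContinuousLinearMap.comp_add]))
      (fun c a x => ((π.tensor ρ).tensor σ).injective
        (by simp only [toHom_tmulAssoc, map_smul, opAssoc, opTensor_smul_left,
          ContinuousLinearMap.smul_comp, ContinuousLinearMap.comp_smul]))
      (fun a x x' => ((π.tensor ρ).tensor σ).injective
        (by simp only [toHom_tmulAssoc, map_add, opAssoc, opTensor_add_right,
          ContinuousLinearMap.add_comp, ContinuousLinearMap.comp_add]))
      (fun c a x => ((π.tensor ρ).tensor σ).injective
        (by simp only [toHom_tmulAssoc, map_smul, opAssoc, opTensor_smul_right,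
          ContinuousLinearMap.smul_comp, ContinuousLinearMap.comp_smul])))
    1 fun a x => by
      rw [one_mul, ← π.norm_map a, ← (ρ.tensor σ).norm_map x]
      change ‖tmulAssoc π ρ σ a x‖ ≤ _
      rw [← ((π.tensor ρ).tensor σ).norm_map, toHom_tmulAssoc]
      exact norm_opAssoc_le _ _

theorem tmulAssocL_apply (a : A) (x : MinTensor ρ σ) :
    tmulAssocL π ρ σ a x = tmulAssoc π ρ σ a x := rfl

theorem tensorFunctional_tmulAssoc (f : A →L[ℂ] ℂ) (g : B →L[ℂ] ℂ) (k : C →L[ℂ] ℂ) (a : A)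
    (x : MinTensor ρ σ) :
    tensorFunctional (π.tensor ρ) σ (tensorFunctional π ρ f g) k (tmulAssoc π ρ σ a x) =
      f a * tensorFunctional ρ σ g k x := by
  have h : tensorFunctional (π.tensor ρ) σ (tensorFunctional π ρ f g) k ∘L tmulAssocL π ρ σ a =
      f a • tensorFunctional ρ σ g k := by
    refine clm_ext_tmul ρ σ fun b c => ?_
    rw [ContinuousLinearMap.comp_apply, tmulAssocL_apply, tmulAssoc_tmul, tensorFunctional_tmul,
      tensorFunctional_tmul, smul_apply, tensorFunctional_tmul, smul_eq_mul, mul_assoc]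
  exact DFunLike.congr_fun h x

/-- A closed subspace that contains the elementary tensors is everything. -/
theorem eq_top_of_tmul_mem (P : Submodule ℂ (MinTensor π ρ))
    (hP : IsClosed (P : Set (MinTensor π ρ))) (h : ∀ a b, tmul π ρ a b ∈ P) : P = ⊤ :=
  eq_top_iff.2 fun x _ =>
    minTensor_induction π ρ P hP (ContinuousLinearMap.id ℂ (MinTensor π ρ)) h x

/-- If a bounded operator maps a set of products `x * y` into a closed subspace, then it maps
everything there: `A * A` is dense in `A`. -/
theorem apply_mem_of_mul {E : Type*} [NormedAddCommGroup E] [NormedSpace ℂ E]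
    (P : Submodule ℂ E) (hP : IsClosed (P : Set E)) (u : A →L[ℂ] E)
    (h : ∀ x y, u (x * y) ∈ P) (x : A) : u x ∈ P := by
  obtain ⟨l, hl, -, hl2, -⟩ := exists_approximateUnit A
  exact hP.mem_of_tendsto ((u.continuous.tendsto x).comp (hl2 x))
    (Eventually.of_forall fun e => h x e)

theorem apply_mem_of_dense {E F : Type*} [NormedAddCommGroup E] [NormedSpace ℂ E]
    [NormedAddCommGroup F] [NormedSpace ℂ F]
    (P : Submodule ℂ E) (hP : IsClosed (P : Set E)) (u : F →L[ℂ] E) {X : Set F}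
    (hX : Dense (Submodule.span ℂ X : Set F)) (h : ∀ x ∈ X, u x ∈ P) (x : F) : u x ∈ P := by
  have hle : Submodule.span ℂ X ≤ P.comap u.toLinearMap := Submodule.span_le.2 h
  have hc : IsClosed {x | u x ∈ P} := hP.preimage u.continuous
  exact hc.closure_subset_iff.2 hle (hX x)

end Triple

namespace HopfCStarAlgebra

variable {S H : Type*} [NonUnitalCStarAlgebra S]
  [NormedAddCommGroup H] [InnerProductSpace ℂ H] [CompleteSpace H]
  {π : FaithfulRep S H} (𝓗 : HopfCStarAlgebra π)

/-! ### Associativity of the product of the dual -/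

/-- `Φ = δ ⊗ id` is non-degenerate. -/
theorem dense_span_comul_tmul (Φ : 𝓜(ℂ, MinTensor π π) →⋆ₐ[ℂ] 𝓜(ℂ, MinTensor (π.tensor π) π))
    (hΦ : ∀ (a c d : S) (x : MinTensor π π),
      (Φ (tmul π π a c : 𝓜(ℂ, MinTensor π π))).fst (tmul (π.tensor π) π x d) =
        tmul (π.tensor π) π ((𝓗.comul a).fst x) (c * d)) :
    Dense (Submodule.span ℂ {b | ∃ (y : MinTensor π π) (z : MinTensor (π.tensor π) π),
      b = (Φ (y : 𝓜(ℂ, MinTensor π π))).fst z} : Set (MinTensor (π.tensor π) π)) := by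
  set V := Submodule.span ℂ {b | ∃ (y : MinTensor π π) (z : MinTensor (π.tensor π) π),
      b = (Φ (y : 𝓜(ℂ, MinTensor π π))).fst z} with hV
  have hc := V.isClosed_topologicalClosure
  rw [Submodule.dense_iff_topologicalClosure_eq_top]
  refine eq_top_of_tmul_mem (π.tensor π) π _ hc fun w d => ?_
  refine apply_mem_of_mul V.topologicalClosure hc (tmulL (π.tensor π) π w) (fun c d => ?_) d
  refine apply_mem_of_dense V.topologicalClosure hc ((tmulL (π.tensor π) π).flip (c * d))
    𝓗.nondegenerate ?_ w
  rintro _ ⟨a, x, rfl⟩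
  exact V.le_topologicalClosure (Submodule.subset_span ⟨_, _, (hΦ a c d x).symm⟩)

/-- `Ψ = id ⊗ δ` is non-degenerate. -/
theorem dense_span_tmulAssoc_comul
    (Ψ : 𝓜(ℂ, MinTensor π π) →⋆ₐ[ℂ] 𝓜(ℂ, MinTensor (π.tensor π) π))
    (hΨ : ∀ (a b c : S) (x : MinTensor π π),
      (Ψ (tmul π π a c : 𝓜(ℂ, MinTensor π π))).fst (tmulAssoc π π π b x) =
        tmulAssoc π π π (a * b) ((𝓗.comul c).fst x)) :
    Dense (Submodule.span ℂ {b | ∃ (y : MinTensor π π) (z : MinTensor (π.tensor π) π),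
      b = (Ψ (y : 𝓜(ℂ, MinTensor π π))).fst z} : Set (MinTensor (π.tensor π) π)) := by
  set V := Submodule.span ℂ {b | ∃ (y : MinTensor π π) (z : MinTensor (π.tensor π) π),
      b = (Ψ (y : 𝓜(ℂ, MinTensor π π))).fst z} with hV
  have hc := V.isClosed_topologicalClosure
  have key : ∀ a x, tmulAssoc π π π a x ∈ V.topologicalClosure := fun a x => by
    refine apply_mem_of_mul V.topologicalClosure hc ((tmulAssocL π π π).flip x) (fun a b => ?_) a
    refine apply_mem_of_dense V.topologicalClosure hc (tmulAssocL π π π (a * b))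
      𝓗.nondegenerate ?_ x
    rintro _ ⟨c, x, rfl⟩
    exact V.le_topologicalClosure (Submodule.subset_span ⟨_, _, (hΨ a b c x).symm⟩)
  rw [Submodule.dense_iff_topologicalClosure_eq_top]
  refine eq_top_of_tmul_mem (π.tensor π) π _ hc fun w c => ?_
  refine minTensor_induction π π V.topologicalClosure hc ((tmulL (π.tensor π) π).flip c)
    (fun a b => ?_) w
  change tmul (π.tensor π) π (tmul π π a b) c ∈ _
  rw [← tmulAssoc_tmul]
  exact key _ _

theorem conv_translate (f g : S →L[ℂ] ℂ) (x y s : S) :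
    𝓗.conv (translate f x) (translate g y) s =
      tensorFunctional π π f g ((𝓗.comul s).fst (tmul π π x y)) := by
  rw [conv_apply, ← translate_tensorFunctional, strictExtension_translate]

theorem conv_assoc (f g k : S →L[ℂ] ℂ) :
    𝓗.conv (𝓗.conv f g) k = 𝓗.conv f (𝓗.conv g k) := by
  obtain ⟨Φ, Ψ, hΦ, hΨ, hΦΨ⟩ := 𝓗.coassoc
  -- all three factors may be taken to be translates
  suffices h : (𝓗.conv.flip k) ∘L (𝓗.conv.flip g) = 𝓗.conv.flip (𝓗.conv g k) from
    DFunLike.congr_fun h f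
  refine clm_ext_translate fun f x => ?_
  suffices h : (𝓗.conv.flip k) ∘L 𝓗.conv (translate f x) =
      𝓗.conv (translate f x) ∘L 𝓗.conv.flip k from DFunLike.congr_fun h g
  refine clm_ext_translate fun g y => ?_
  suffices h : 𝓗.conv (𝓗.conv (translate f x) (translate g y)) =
      𝓗.conv (translate f x) ∘L 𝓗.conv (translate g y) from DFunLike.congr_fun h k
  refine clm_ext_translate fun k z => ?_
  ext s
  change 𝓗.conv (𝓗.conv (translate f x) (translate g y)) (translate k z) s =
    𝓗.conv (translate f x) (𝓗.conv (translate g y) (translate k z)) s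
  set P := tensorFunctional (π.tensor π) π (tensorFunctional π π f g) k with hP
  set E := tmul (π.tensor π) π (tmul π π x y) z with hE
  have h1 : pullback Φ (translate P E) =
      tensorFunctional π π (𝓗.conv (translate f x) (translate g y)) (translate k z) := by
    refine clm_ext_tmul π π fun a c => ?_
    rw [pullback_apply, strictExtension_translate, hE, hΦ, hP, tensorFunctional_tmul,
      tensorFunctional_tmul, conv_translate]
    rfl
  have h2 : pullback Ψ (translate P E) =
      tensorFunctional π π (translate f x) (𝓗.conv (translate g y) (translate k z)) := by
    refine clm_ext_tmul π π fun a c => ?_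
    rw [pullback_apply, strictExtension_translate, hE, ← tmulAssoc_tmul, hΨ, hP,
      tensorFunctional_tmulAssoc, tensorFunctional_tmul, conv_translate]
    rfl
  rw [conv_apply, conv_apply, ← h1, ← h2,
    strictExtension_pullback Φ (𝓗.dense_span_comul_tmul Φ hΦ),
    strictExtension_pullback Ψ (𝓗.dense_span_tmulAssoc_comul Ψ hΨ), hΦΨ]

/-! ### Separate weak* continuity and faithfulness of the product -/

/-- `g ↦ f g` is weak*-continuous. -/
theorem exists_conv_eq_left (f : S →L[ℂ] ℂ) (s : S) :
    ∃ x : S, ∀ g : S →L[ℂ] ℂ, 𝓗.conv f g s = g x := by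
  let ev : (S →L[ℂ] ℂ) →L[ℂ] ℂ := ContinuousLinearMap.apply ℂ ℂ s
  let u : (S →L[ℂ] ℂ) →L[ℂ] ((S →L[ℂ] ℂ) →L[ℂ] ℂ) :=
    ContinuousLinearMap.compL ℂ (S →L[ℂ] ℂ) (S →L[ℂ] ℂ) ℂ ev ∘L 𝓗.conv
  refine apply_mem_of_translate (E := (S →L[ℂ] ℂ) →L[ℂ] ℂ) (evaluations S)
    (isClosed_evaluations S) u (fun f t => ?_) f
  obtain ⟨y, hy⟩ := 𝓗.comul_mul_tmulOne s t
  obtain ⟨x, hx⟩ := exists_slice_left π π f y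
  refine ⟨x, fun g => ?_⟩
  change 𝓗.conv (translate f t) g s = g x
  rw [conv_apply, tensorFunctional_translate_left, strictExtension_comp_snd, hy,
    strictExtension_coe, hx]

/-- `f ↦ f g` is weak*-continuous. -/
theorem exists_conv_eq_right (g : S →L[ℂ] ℂ) (s : S) :
    ∃ x : S, ∀ f : S →L[ℂ] ℂ, 𝓗.conv f g s = f x := by
  let ev : (S →L[ℂ] ℂ) →L[ℂ] ℂ := ContinuousLinearMap.apply ℂ ℂ s
  let u : (S →L[ℂ] ℂ) →L[ℂ] ((S →L[ℂ] ℂ) →L[ℂ] ℂ) :=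
    ContinuousLinearMap.compL ℂ (S →L[ℂ] ℂ) (S →L[ℂ] ℂ) ℂ ev ∘L 𝓗.conv.flip
  refine apply_mem_of_translate (E := (S →L[ℂ] ℂ) →L[ℂ] ℂ) (evaluations S)
    (isClosed_evaluations S) u (fun g t => ?_) g
  obtain ⟨y, hy⟩ := 𝓗.comul_mul_oneTmul s t
  obtain ⟨x, hx⟩ := exists_slice_right π π g y
  refine ⟨x, fun f => ?_⟩
  change 𝓗.conv f (translate g t) s = f x
  rw [conv_apply, tensorFunctional_translate_right, strictExtension_comp_snd, hy,
    strictExtension_coe, hx]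

theorem exists_apply_ne_zero {A : Submodule ℂ (S →L[ℂ] ℂ)} (hA : A ≠ ⊥) :
    ∃ a ∈ A, ∃ t, a t ≠ 0 := by
  obtain ⟨a, ha, ha0⟩ := A.ne_bot_iff.1 hA
  obtain ⟨t, ht⟩ := DFunLike.ne_iff.1 ha0
  exact ⟨a, ha, t, ht⟩

variable {𝓗}

/-- A non-zero invariant subspace of `S*` has no left annihilator in `S*`. -/
theorem IsSaturated.eq_zero_of_conv_left (hsat : 𝓗.IsSaturated) {A : Submodule ℂ (S →L[ℂ] ℂ)}
    (hA : A ≠ ⊥) (hinv : IsInvariant A) {h : S →L[ℂ] ℂ} (hh : ∀ a ∈ A, 𝓗.conv h a = 0) :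
    h = 0 := by
  obtain ⟨a, ha, t, hat⟩ := exists_apply_ne_zero hA
  have h0 : tensorFunctional π π h a = 0 := by
    refine ContinuousLinearMap.ext_on hsat.dense_oneTmul ?_
    rintro x ⟨s, t, hx⟩
    have := DFunLike.congr_fun (hh (translate a t) (hinv a ha t).1) s
    rw [conv_apply, tensorFunctional_translate_right, strictExtension_comp_snd, hx,
      strictExtension_coe] at this
    exact this
  ext s
  have := DFunLike.congr_fun h0 (tmul π π s t)
  rw [tensorFunctional_tmul] at this
  exact (mul_eq_zero.1 this).resolve_right hat

/-- A non-zero invariant subspace of `S*` has no right annihilator in `S*`. -/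
theorem IsSaturated.eq_zero_of_conv_right (hsat : 𝓗.IsSaturated) {A : Submodule ℂ (S →L[ℂ] ℂ)}
    (hA : A ≠ ⊥) (hinv : IsInvariant A) {h : S →L[ℂ] ℂ} (hh : ∀ a ∈ A, 𝓗.conv a h = 0) :
    h = 0 := by
  obtain ⟨a, ha, t, hat⟩ := exists_apply_ne_zero hA
  have h0 : tensorFunctional π π a h = 0 := by
    refine ContinuousLinearMap.ext_on hsat.dense_tmulOne ?_
    rintro x ⟨s, t, hx⟩
    have := DFunLike.congr_fun (hh (translate a t) (hinv a ha t).1) s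
    rw [conv_apply, tensorFunctional_translate_left, strictExtension_comp_snd, hx,
      strictExtension_coe] at this
    exact this
  ext s
  have := DFunLike.congr_fun h0 (tmul π π t s)
  rw [tensorFunctional_tmul] at this
  exact (mul_eq_zero.1 this).resolve_left hat

end HopfCStarAlgebra

/-! ### Minimality of the C⋆-norm -/

section Minimality

variable {S : Type*} [NonUnitalCStarAlgebra S] {N : S → ℝ}

/-- If `N x < c < ‖x‖`, functional calculus gives `y ≠ 0` and `z` with `y * (x * z) = y` and
`‖z‖ ≤ c⁻¹`, and then `N y ≤ N y * N x * N z` forces `N y = 0`. -/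
theorem le_of_submultiplicative_of_isSelfAdjoint (hN : ∀ s, 0 ≤ N s)
    (hmul : ∀ s t, N (s * t) ≤ N s * N t) (hle : ∀ s, N s ≤ ‖s‖) (h0 : ∀ s, N s = 0 → s = 0)
    {x : S} (hx : IsSelfAdjoint x) : ‖x‖ ≤ N x := by
  by_contra! hlt
  obtain ⟨c, hc1, hc2⟩ := exists_between hlt
  have hc : 0 < c := (hN _).trans_lt hc1
  -- `g` is supported where `|t| > c`, and there `k t = 1 / t`, so that `g x * (x * k x) = g x`
  let g : ℝ → ℝ := fun t => max (|t| - c) 0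
  let k : ℝ → ℝ := fun t => t / max (c ^ 2) (t ^ 2)
  have hmax : ∀ t : ℝ, 0 < max (c ^ 2) (t ^ 2) := fun t => lt_max_of_lt_left (by positivity)
  have hgc : Continuous g := by fun_prop
  have hkc : Continuous k := continuous_id.div (by fun_prop) fun t => (hmax t).ne'
  have hg0 : g 0 = 0 := by simp [g, hc.le]
  have hk0 : k 0 = 0 := by simp [k]
  have hk : ‖cfcₙ k x‖ ≤ c⁻¹ := by
    refine norm_cfcₙ_le (𝕜 := ℝ) fun t _ => ?_
    rw [Real.norm_eq_abs, abs_div, abs_of_pos (hmax t), div_le_iff₀ (hmax t),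
      ← div_eq_inv_mul, le_div_iff₀ hc]
    rcases le_total |t| c with h | h
    · exact (by nlinarith : |t| * c ≤ c ^ 2).trans (le_max_left _ _)
    · exact (by nlinarith [sq_abs t] : |t| * c ≤ t ^ 2).trans (le_max_right _ _)
  have hgk : ∀ t, g t * (t * k t) = g t := fun t => by
    rcases le_total |t| c with h | h
    · simp [g, h]
    · have h2 : c ^ 2 ≤ t ^ 2 := by rw [← sq_abs t]; gcongr
      have ht : t ≠ 0 := by rintro rfl; simp at h; linarith
      have : t * k t = 1 := by
        simp only [k, max_eq_right h2]; field_simp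
      rw [this, mul_one]
  have hy : cfcₙ g x * (x * cfcₙ k x) = cfcₙ g x := by
    have e1 : x * cfcₙ k x = cfcₙ (fun t => t * k t) x := by
      rw [cfcₙ_mul (fun t : ℝ => t) k x, cfcₙ_id' ℝ x]
    have e2 : cfcₙ g x * cfcₙ (fun t => t * k t) x = cfcₙ (fun t => g t * (t * k t)) x :=
      (cfcₙ_mul g (fun t => t * k t) x (hg := by fun_prop) (hg0 := by simp)).symm
    rw [e1, e2]
    simp only [hgk]
  -- hence `N (g x) ≤ N (g x) * N x * N (k x)`, where `N x * N (k x) < c * c⁻¹`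
  have hy0 : cfcₙ g x = 0 := by
    refine h0 _ (le_antisymm ?_ (hN _))
    by_contra! hpos
    have h1 : N (x * cfcₙ k x) < 1 := by
      calc _ ≤ N x * N (cfcₙ k x) := hmul _ _
        _ ≤ N x * c⁻¹ := by gcongr; exacts [hN _, (hle _).trans hk]
        _ < c * c⁻¹ := by gcongr
        _ = 1 := mul_inv_cancel₀ hc.ne'
    have h2 : N (cfcₙ g x) ≤ N (cfcₙ g x) * N (x * cfcₙ k x) := by
      conv_lhs => rw [← hy]
      exact hmul _ _
    nlinarith
  have hle : ‖x‖ ≤ c := by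
    conv_lhs => rw [← cfcₙ_id' ℝ x]
    refine norm_cfcₙ_le (𝕜 := ℝ) fun t ht => ?_
    have h := norm_apply_le_norm_cfcₙ g x ht
    rw [hy0, norm_zero, norm_le_zero_iff] at h
    have h2 : |t| - c ≤ g t := le_max_left _ _
    rw [Real.norm_eq_abs]
    linarith
  linarith

/-- The norm of a C⋆-algebra is minimal among submultiplicative norms: a submultiplicative
faithful function that is dominated by the norm is equal to it. -/
theorem norm_eq_of_submultiplicative (hN : ∀ s, 0 ≤ N s)
    (hmul : ∀ s t, N (s * t) ≤ N s * N t) (hle : ∀ s, N s ≤ ‖s‖) (h0 : ∀ s, N s = 0 → s = 0)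
    (s : S) : N s = ‖s‖ := by
  refine le_antisymm (hle s) ?_
  have h1 : ‖s‖ * ‖s‖ ≤ ‖s‖ * N s := by
    calc ‖s‖ * ‖s‖ = ‖star s * s‖ := CStarRing.norm_star_mul_self.symm
      _ ≤ N (star s * s) :=
        le_of_submultiplicative_of_isSelfAdjoint hN hmul hle h0 (IsSelfAdjoint.star_mul_self s)
      _ ≤ N (star s) * N s := hmul _ _
      _ ≤ ‖s‖ * N s := by
        gcongr
        · exact hN s
        · exact (hle _).trans_eq (norm_star s)
  rcases eq_or_lt_of_le (norm_nonneg s) with h | h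
  · rw [← h]; exact hN s
  · exact le_of_mul_le_mul_left h1 h

end Minimality

/-! ### Functionals on `S` induced by the double dual of a subspace of `S*` -/

section Evaluation

variable {S E : Type*} [NonUnitalCStarAlgebra S] [NormedAddCommGroup E] [NormedSpace ℂ E]

/-- The functional `s ↦ U (a ↦ T a s)` on `S`, for `U` in the double dual of `E` and an operator
`T : E → S*`. It is the weak* limit of `T a` when `U` is the weak* limit of `a`. -/
def weakLimit (U : (E →L[ℂ] ℂ) →L[ℂ] ℂ) (T : E →L[ℂ] (S →L[ℂ] ℂ)) : S →L[ℂ] ℂ := U ∘L T.flip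

theorem weakLimit_apply (U : (E →L[ℂ] ℂ) →L[ℂ] ℂ) (T : E →L[ℂ] (S →L[ℂ] ℂ)) (s : S) :
    weakLimit U T s = U (T.flip s) := rfl

theorem weakLimit_apply_eq_zero (U : (E →L[ℂ] ℂ) →L[ℂ] ℂ) {T : E →L[ℂ] (S →L[ℂ] ℂ)} {s : S}
    (h : ∀ a, T a s = 0) : weakLimit U T s = 0 := by
  rw [weakLimit_apply, show T.flip s = 0 from ContinuousLinearMap.ext h, map_zero]

variable (j : E →ₗᵢ[ℂ] (S →L[ℂ] ℂ))

/-- If an invariant subspace `E` of `S*`, given by its inclusion `j`, separates the points of `S`,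
then `S → E*` is isometric: the operator norm of the action of `s` on `E` by `f ↦ f (· s)` is a
submultiplicative norm on `S`, and it is at most the norm of `s` in `E*`. -/
theorem norm_flip_eq (hleft : ∀ a s, ∃ b, j b = translate (j a) s)
    (hright : ∀ a s, ∃ b, j b = j a ∘L ContinuousLinearMap.mul ℂ S s)
    (hsep : ∀ s, (∀ a, j a s = 0) → s = 0) (s : S) :
    ‖j.toContinuousLinearMap.flip s‖ = ‖s‖ := by
  let act : S → E →L[ℂ] (S →L[ℂ] ℂ) := fun s =>
    (ContinuousLinearMap.compL ℂ S S ℂ).flip ((ContinuousLinearMap.mul ℂ S).flip s) ∘L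
      j.toContinuousLinearMap
  have hact : ∀ s a, act s a = translate (j a) s := fun s a => rfl
  have hN : ∀ s, ‖act s‖ = ‖s‖ := by
    refine norm_eq_of_submultiplicative (N := fun s => ‖act s‖) (fun s => (act s).opNorm_nonneg)
      (fun s t => ?_) (fun s => ?_) (fun s hs => ?_)
    · refine ContinuousLinearMap.opNorm_le_bound _ (by positivity) fun a => ?_
      obtain ⟨b, hb⟩ := hleft a t
      have h1 : act (s * t) a = act s b := by
        ext x
        rw [hact, hact, hb, translate_apply, translate_apply, translate_apply, mul_assoc]
      calc ‖act (s * t) a‖ = ‖act s b‖ := by rw [h1]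
        _ ≤ ‖act s‖ * ‖b‖ := (act s).le_opNorm b
        _ = ‖act s‖ * ‖act t a‖ := by rw [← j.norm_map b, hb, hact]
        _ ≤ ‖act s‖ * (‖act t‖ * ‖a‖) := by gcongr; exact (act t).le_opNorm a
        _ = _ := by ring
    · refine ContinuousLinearMap.opNorm_le_bound _ (norm_nonneg _) fun a => ?_
      refine ContinuousLinearMap.opNorm_le_bound _ (by positivity) fun x => ?_
      rw [hact, translate_apply]
      calc _ ≤ ‖j a‖ * ‖x * s‖ := (j a).le_opNorm _
        _ ≤ ‖a‖ * (‖x‖ * ‖s‖) := by rw [j.norm_map]; gcongr; exact norm_mul_le _ _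
        _ = _ := by ring
    · refine mul_left_faithful fun x => ?_
      rw [mul_zero]
      refine hsep _ fun a => ?_
      rw [← translate_apply, ← hact, (act s).opNorm_zero_iff.1 hs]
      rfl
  refine le_antisymm ?_ ?_
  · refine ContinuousLinearMap.opNorm_le_bound _ (norm_nonneg _) fun a => ?_
    calc ‖j a s‖ ≤ ‖j a‖ * ‖s‖ := (j a).le_opNorm s
      _ = _ := by rw [j.norm_map, mul_comm]
  · rw [← hN s]
    refine ContinuousLinearMap.opNorm_le_bound _ (norm_nonneg _) fun a => ?_
    refine ContinuousLinearMap.opNorm_le_bound _ (by positivity) fun x => ?_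
    -- `a (x * s)` is the value at `s` of the functional `a (x * ·)`, which is again in `E`
    obtain ⟨b, hb⟩ := hright a x
    have hbn : ‖b‖ ≤ ‖a‖ * ‖x‖ := by
      rw [← j.norm_map b, hb, ← j.norm_map a]
      refine (ContinuousLinearMap.opNorm_comp_le _ _).trans ?_
      gcongr
      exact ContinuousLinearMap.opNorm_mul_apply_le ℂ S x
    calc ‖act s a x‖ = ‖j b s‖ := by rw [hb]; rfl
      _ ≤ ‖j.toContinuousLinearMap.flip s‖ * ‖b‖ :=
        (j.toContinuousLinearMap.flip s).le_opNorm b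
      _ ≤ ‖j.toContinuousLinearMap.flip s‖ * (‖a‖ * ‖x‖) := by gcongr
      _ = _ := by ring

/-- Every functional on `S` is induced by an element of the double dual of an invariant separating
subspace. -/
theorem exists_weakLimit_eq (hleft : ∀ a s, ∃ b, j b = translate (j a) s)
    (hright : ∀ a s, ∃ b, j b = j a ∘L ContinuousLinearMap.mul ℂ S s)
    (hsep : ∀ s, (∀ a, j a s = 0) → s = 0) (f : S →L[ℂ] ℂ) :
    ∃ U : (E →L[ℂ] ℂ) →L[ℂ] ℂ, weakLimit U j.toContinuousLinearMap = f := by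
  let ι : S →ₗᵢ[ℂ] (E →L[ℂ] ℂ) :=
    ⟨j.toContinuousLinearMap.flip.toLinearMap, norm_flip_eq j hleft hright hsep⟩
  let e := ι.equivRange
  obtain ⟨U, hU, -⟩ := exists_extension_norm_eq (LinearMap.range ι.toLinearMap)
    (f ∘L (e.symm.toLinearIsometry.toContinuousLinearMap))
  refine ⟨U, ContinuousLinearMap.ext fun s => (hU (e s)).trans ?_⟩
  change f (e.symm (e s)) = f s
  rw [e.symm_apply_apply]

/-- A bounded filter has a weak* cluster point in the double dual. -/
theorem exists_doubleDual_of_bounded (l : Filter E) [l.NeBot] {C : ℝ} (hC : ∀ᶠ e in l, ‖e‖ ≤ C) :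
    ∃ U : (E →L[ℂ] ℂ) →L[ℂ] ℂ, ∀ (φ : E →L[ℂ] ℂ) (c : ℂ), Tendsto φ l (𝓝 c) → U φ = c := by
  let i : E → WeakDual ℂ (E →L[ℂ] ℂ) := fun e =>
    StrongDual.toWeakDual (NormedSpace.inclusionInDoubleDual ℂ E e)
  have hi : ∀ᶠ e in l, i e ∈ WeakDual.toStrongDual ⁻¹'
      Metric.closedBall (0 : StrongDual ℂ (E →L[ℂ] ℂ)) C := hC.mono fun e he => by
    change NormedSpace.inclusionInDoubleDual ℂ E e ∈
      Metric.closedBall (0 : StrongDual ℂ (E →L[ℂ] ℂ)) C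
    exact (mem_closedBall_zero_iff (E := StrongDual ℂ (E →L[ℂ] ℂ))).2
      ((NormedSpace.double_dual_bound ℂ E e).trans he)
  obtain ⟨U, -, hU⟩ := WeakDual.isCompact_closedBall (0 : StrongDual ℂ (E →L[ℂ] ℂ)) C
    (show l.map i ≤ _ from tendsto_principal.2 hi)
  refine ⟨WeakDual.toStrongDual U, fun φ c hφ => ?_⟩
  have h1 : MapClusterPt (U φ) l φ :=
    MapClusterPt.continuousAt_comp (f := fun V : WeakDual ℂ (E →L[ℂ] ℂ) => V φ)
      (WeakDual.eval_continuous φ).continuousAt (show MapClusterPt U l i from hU)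
  exact @eq_of_nhds_neBot _ _ _ _ _ (ClusterPt.mono h1 hφ)

end Evaluation

namespace HopfCStarAlgebra

variable {S H : Type*} [NonUnitalCStarAlgebra S]
  [NormedAddCommGroup H] [InnerProductSpace ℂ H] [CompleteSpace H]
  {π : FaithfulRep S H} (𝓗 : HopfCStarAlgebra π)

/-! ### Products with weak* limits -/

section WeakLimit

variable {E : Type*} [NormedAddCommGroup E] [NormedSpace ℂ E]

theorem conv_weakLimit_left (U : (E →L[ℂ] ℂ) →L[ℂ] ℂ) (T : E →L[ℂ] (S →L[ℂ] ℂ))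
    (b : S →L[ℂ] ℂ) : 𝓗.conv b (weakLimit U T) = weakLimit U (𝓗.conv b ∘L T) := by
  ext s
  obtain ⟨x, hx⟩ := 𝓗.exists_conv_eq_left b s
  rw [hx, weakLimit_apply, weakLimit_apply]
  congr 1
  ext a
  exact (hx (T a)).symm

theorem conv_weakLimit_right (U : (E →L[ℂ] ℂ) →L[ℂ] ℂ) (T : E →L[ℂ] (S →L[ℂ] ℂ))
    (b : S →L[ℂ] ℂ) : 𝓗.conv (weakLimit U T) b = weakLimit U (𝓗.conv.flip b ∘L T) := by
  ext s
  obtain ⟨x, hx⟩ := 𝓗.exists_conv_eq_right b s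
  rw [hx, weakLimit_apply, weakLimit_apply]
  congr 1
  ext a
  exact (hx (T a)).symm

/-- Along a bounded filter on `E`, operators that converge in norm have their limit as
`weakLimit`. -/
theorem exists_weakLimit_of_bounded (l : Filter E) [l.NeBot] {C : ℝ} (hC : ∀ᶠ e in l, ‖e‖ ≤ C) :
    ∃ U, ∀ (T : E →L[ℂ] (S →L[ℂ] ℂ)) (f : S →L[ℂ] ℂ), Tendsto T l (𝓝 f) →
      weakLimit U T = f := by
  obtain ⟨U, hU⟩ := exists_doubleDual_of_bounded l hC
  refine ⟨U, fun T f hT => ContinuousLinearMap.ext fun s => ?_⟩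
  rw [weakLimit_apply]
  exact hU _ _ (((ContinuousLinearMap.apply ℂ ℂ s).continuous.tendsto f).comp hT)

end WeakLimit

/-! ### Consequences of a bounded approximate identity -/

section ApproximateIdentity

variable {𝓗} {A : Submodule ℂ (S →L[ℂ] ℂ)}

theorem eq_zero_of_forall_apply_eq_zero {s : S} (h : ∀ f : S →L[ℂ] ℂ, f s = 0) : s = 0 :=
  SeparatingDual.eq_zero_of_forall_dual_eq_zero (R := ℂ) h

/-- A left ideal with a bounded left approximate identity contains in its weak* closure an element
`u` with `u a = a`. As the ideal has no left annihilator, `u` is a unit of `S*`; so the ideal is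
weak*-dense. -/
theorem IsSaturated.dualUnital_of_hasLeftBAI (hsat : 𝓗.IsSaturated) (hA : A ≠ ⊥)
    (hinv : IsInvariant A) (hmul : ∀ h, ∀ a ∈ A, 𝓗.conv h a ∈ A) (hbai : 𝓗.HasLeftBAI A) :
    𝓗.DualUnital ∧ ∀ s, (∀ a ∈ A, a s = 0) → s = 0 := by
  obtain ⟨l, C, hl, hC, hlim⟩ := hbai
  obtain ⟨U, hU⟩ := exists_weakLimit_of_bounded (S := S) (E := A) l hC
  set u := weakLimit (E := A) U A.subtypeL with hu
  have hua : ∀ a ∈ A, 𝓗.conv u a = a := fun a ha => by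
    rw [hu, conv_weakLimit_right]
    exact hU _ _ (hlim ⟨a, ha⟩)
  have hright : ∀ h, 𝓗.conv h u = h := fun h => by
    rw [← sub_eq_zero]
    refine hsat.eq_zero_of_conv_left hA hinv fun a ha => ?_
    rw [map_sub, sub_apply, conv_assoc, hua a ha, sub_self]
  have hleft : ∀ h, 𝓗.conv u h = h := fun h => by
    rw [← sub_eq_zero]
    refine hsat.eq_zero_of_conv_left hA hinv fun a ha => ?_
    rw [map_sub, sub_apply, conv_assoc, hua _ (hmul h a ha), sub_self]
  refine ⟨⟨u, fun h => ⟨hleft h, hright h⟩⟩, fun s hs => ?_⟩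
  refine eq_zero_of_forall_apply_eq_zero fun h => ?_
  rw [← hright h, hu, conv_weakLimit_left]
  exact weakLimit_apply_eq_zero (E := A) U fun a => hs _ (hmul h a a.2)

theorem IsSaturated.dualUnital_of_hasRightBAI (hsat : 𝓗.IsSaturated) (hA : A ≠ ⊥)
    (hinv : IsInvariant A) (hmul : ∀ h, ∀ a ∈ A, 𝓗.conv a h ∈ A) (hbai : 𝓗.HasRightBAI A) :
    𝓗.DualUnital ∧ ∀ s, (∀ a ∈ A, a s = 0) → s = 0 := by
  obtain ⟨l, C, hl, hC, hlim⟩ := hbai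
  obtain ⟨U, hU⟩ := exists_weakLimit_of_bounded (S := S) (E := A) l hC
  set u := weakLimit (E := A) U A.subtypeL with hu
  have hau : ∀ a ∈ A, 𝓗.conv a u = a := fun a ha => by
    rw [hu, conv_weakLimit_left]
    exact hU _ _ (hlim ⟨a, ha⟩)
  have hleft : ∀ h, 𝓗.conv u h = h := fun h => by
    rw [← sub_eq_zero]
    refine hsat.eq_zero_of_conv_right hA hinv fun a ha => ?_
    rw [map_sub, ← conv_assoc, hau a ha, sub_self]
  have hright : ∀ h, 𝓗.conv h u = h := fun h => by
    rw [← sub_eq_zero]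
    refine hsat.eq_zero_of_conv_right hA hinv fun a ha => ?_
    rw [map_sub, ← conv_assoc, hau _ (hmul h a ha), sub_self]
  refine ⟨⟨u, fun h => ⟨hleft h, hright h⟩⟩, fun s hs => ?_⟩
  refine eq_zero_of_forall_apply_eq_zero fun h => ?_
  rw [← hleft h, hu, conv_weakLimit_right]
  exact weakLimit_apply_eq_zero (E := A) U fun a => hs _ (hmul h a a.2)

/-- A left multiplier `l` is multiplication by the weak* limit of `l e`, where `e` runs through a
bounded left approximate identity. -/
theorem exists_eq_conv_of_mem_leftMultipliers (hmul : ∀ h, ∀ a ∈ A, 𝓗.conv h a ∈ A)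
    (hbai : 𝓗.HasLeftBAI A) {m : A →L[ℂ] A} (hm : m ∈ 𝓗.leftMultipliers A) :
    ∃ h, ∀ a : A, 𝓗.conv h a = m a := by
  obtain ⟨l, C, hl, hC, hlim⟩ := hbai
  obtain ⟨U, hU⟩ := exists_weakLimit_of_bounded (S := S) (E := A) l hC
  refine ⟨weakLimit (E := A) U (A.subtypeL ∘L m), fun a => ?_⟩
  rw [conv_weakLimit_right]
  refine hU _ _ ?_
  have h1 : Tendsto (fun e : A => (⟨𝓗.conv e a, hmul e a a.2⟩ : A)) l (𝓝 a) :=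
    tendsto_subtype_rng.2 (hlim a)
  have h2 := (continuous_subtype_val.tendsto (m a)).comp ((m.continuous.tendsto a).comp h1)
  exact h2.congr fun e => hm e a _

theorem exists_eq_conv_of_mem_rightMultipliers (hmul : ∀ h, ∀ a ∈ A, 𝓗.conv a h ∈ A)
    (hbai : 𝓗.HasRightBAI A) {m : A →L[ℂ] A} (hm : m ∈ 𝓗.rightMultipliers A) :
    ∃ h, ∀ a : A, 𝓗.conv a h = m a := by
  obtain ⟨l, C, hl, hC, hlim⟩ := hbai
  obtain ⟨U, hU⟩ := exists_weakLimit_of_bounded (S := S) (E := A) l hC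
  refine ⟨weakLimit (E := A) U (A.subtypeL ∘L m), fun a => ?_⟩
  rw [conv_weakLimit_left]
  refine hU _ _ ?_
  have h1 : Tendsto (fun e : A => (⟨𝓗.conv a e, hmul e a a.2⟩ : A)) l (𝓝 a) :=
    tendsto_subtype_rng.2 (hlim a)
  have h2 := (continuous_subtype_val.tendsto (m a)).comp ((m.continuous.tendsto a).comp h1)
  exact h2.congr fun e => hm a e _

/-- If `S*` has a unit `u` and the ideal `A` separates the points of `S`, then `u` is the weak*
limit of a bounded net in `A`, and a multiplier `(l, r)` is multiplication by the weak* limit `h`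
of `l e` along this net: `b l(e) = r(b) e` tends to `b h` and to `r(b) u = r(b)`, and the
identity for `l` follows as `A` has no right annihilator. -/
theorem IsSaturated.exists_eq_conv_of_mem_multipliers (hsat : 𝓗.IsSaturated) (hA : A ≠ ⊥)
    (hinv : IsInvariant A) (hunit : 𝓗.DualUnital) (hsep : SeparatesPoints A)
    {m : (A →L[ℂ] A) × (A →L[ℂ] A)} (hm : m ∈ 𝓗.multipliers A) :
    ∃ h, ∀ a : A, 𝓗.conv h a = m.1 a ∧ 𝓗.conv a h = m.2 a := by
  obtain ⟨u, hu⟩ := hunit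
  obtain ⟨U, hU⟩ := exists_weakLimit_eq (E := A) A.subtypeₗᵢ
    (fun a s => ⟨⟨_, (hinv a a.2 s).1⟩, rfl⟩) (fun a s => ⟨⟨_, (hinv a a.2 s).2⟩, rfl⟩)
    (fun s hs => by
      by_contra hne
      obtain ⟨f, hf, hne⟩ := hsep s 0 hne
      exact hne ((hs ⟨f, hf⟩).trans (map_zero f).symm)) u
  set h := weakLimit (E := A) U (A.subtypeL ∘L m.1) with hh
  have hr : ∀ b : A, 𝓗.conv b h = m.2 b := fun b => by
    have e : 𝓗.conv b ∘L A.subtypeL ∘L m.1 = 𝓗.conv (m.2 b) ∘L A.subtypeL :=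
      ContinuousLinearMap.ext fun a => hm.2.2 b a
    rw [hh, conv_weakLimit_left, e, ← conv_weakLimit_left]
    exact (congrArg _ hU).trans (hu _).2
  refine ⟨h, fun a => ⟨?_, hr a⟩⟩
  rw [← sub_eq_zero]
  refine hsat.eq_zero_of_conv_right hA hinv fun b hb => ?_
  rw [map_sub, ← conv_assoc, hr ⟨b, hb⟩, hm.2.2 ⟨b, hb⟩ a, sub_self]

end ApproximateIdentity

/-! ### The Fourier algebras -/

section Fourier

theorem isInvariant_sInf {𝒜 : Set (Submodule ℂ (S →L[ℂ] ℂ))} (h : ∀ A ∈ 𝒜, IsInvariant A) :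
    IsInvariant (sInf 𝒜) := fun f hf s => by
  rw [Submodule.mem_sInf] at hf
  exact ⟨Submodule.mem_sInf.2 fun A hA => (h A hA f (hf A hA) s).1,
    Submodule.mem_sInf.2 fun A hA => (h A hA f (hf A hA) s).2⟩

theorem isInvariant_leftFourier : IsInvariant 𝓗.leftFourier :=
  isInvariant_sInf fun _ hA => IsLeftHopfIdeal.invariant hA

theorem isInvariant_rightFourier : IsInvariant 𝓗.rightFourier :=
  isInvariant_sInf fun _ hA => IsRightHopfIdeal.invariant hA

theorem isInvariant_fourier : IsInvariant 𝓗.fourier :=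
  isInvariant_sInf fun _ hA => IsHopfIdeal.invariant hA

theorem isHopfIdeal_fourier (h : 𝓗.fourier ≠ ⊥) : 𝓗.IsHopfIdeal 𝓗.fourier where
  ne_bot := h
  isClosed := by
    rw [fourier, Submodule.coe_sInf]
    exact isClosed_biInter fun A hA => IsHopfIdeal.isClosed hA
  invariant := 𝓗.isInvariant_fourier
  mul_mem_left h _ hf := 𝓗.conv_mem_fourier_left h hf
  mul_mem_right h _ hf := 𝓗.conv_mem_fourier_right h hf

theorem separatesPoints_of_le {A B : Submodule ℂ (S →L[ℂ] ℂ)} (hAB : A ≤ B)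
    (h : ∀ s, (∀ a ∈ A, a s = 0) → s = 0) : SeparatesPoints B := fun s t hst => by
  by_contra! hall
  refine hst (sub_eq_zero.1 (h _ fun a ha => ?_))
  rw [map_sub, hall a (hAB ha), sub_self]

variable {𝓗}

theorem LeftH1.leftH2 (hsat : 𝓗.IsSaturated) (h : 𝓗.LeftH1) : 𝓗.LeftH2 := by
  obtain ⟨hunit, hsep⟩ := hsat.dualUnital_of_hasLeftBAI h.1 𝓗.isInvariant_leftFourier
    (fun _ _ => 𝓗.conv_mem_leftFourier _) h.2
  exact ⟨hunit, fun A hA => separatesPoints_of_le (sInf_le hA) hsep⟩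

theorem RightH1.rightH2 (hsat : 𝓗.IsSaturated) (h : 𝓗.RightH1) : 𝓗.RightH2 := by
  obtain ⟨hunit, hsep⟩ := hsat.dualUnital_of_hasRightBAI h.1 𝓗.isInvariant_rightFourier
    (fun _ _ => 𝓗.conv_mem_rightFourier _) h.2
  exact ⟨hunit, fun A hA => separatesPoints_of_le (sInf_le hA) hsep⟩

theorem TwoSidedH1.twoSidedH2 (hsat : 𝓗.IsSaturated) (h : 𝓗.TwoSidedH1) : 𝓗.TwoSidedH2 := by
  obtain ⟨hne, l, C, hl, hC, hlim⟩ := h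
  obtain ⟨hunit, hsep⟩ := hsat.dualUnital_of_hasLeftBAI hne 𝓗.isInvariant_fourier
    (fun _ _ => 𝓗.conv_mem_fourier_left _) ⟨l, C, hl, hC, fun a => (hlim a).1⟩
  exact ⟨hunit, fun A hA => separatesPoints_of_le (sInf_le hA) hsep⟩

theorem LeftH1.leftH3 (h : 𝓗.LeftH1) : 𝓗.LeftH3 := by
  refine Set.Subset.antisymm ?_ fun m hm => ?_
  · rintro _ ⟨g, rfl⟩ a b hab
    exact (𝓗.conv_assoc g a b).symm
  · obtain ⟨g, hg⟩ := exists_eq_conv_of_mem_leftMultipliers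
      (fun _ _ => 𝓗.conv_mem_leftFourier _) h.2 hm
    exact ⟨g, ContinuousLinearMap.ext fun a => Subtype.ext (hg a)⟩

theorem RightH1.rightH3 (h : 𝓗.RightH1) : 𝓗.RightH3 := by
  refine Set.Subset.antisymm ?_ fun m hm => ?_
  · rintro _ ⟨g, rfl⟩ a b hab
    exact 𝓗.conv_assoc a b g
  · obtain ⟨g, hg⟩ := exists_eq_conv_of_mem_rightMultipliers
      (fun _ _ => 𝓗.conv_mem_rightFourier _) h.2 hm
    exact ⟨g, ContinuousLinearMap.ext fun a => Subtype.ext (hg a)⟩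

theorem TwoSidedH2.twoSidedH3 (hsat : 𝓗.IsSaturated) (h : 𝓗.TwoSidedH2) : 𝓗.TwoSidedH3 := by
  refine Set.Subset.antisymm ?_ fun m hm => ?_
  · rintro _ ⟨g, rfl⟩
    exact ⟨fun a b hab => (𝓗.conv_assoc g a b).symm, fun a b hab => 𝓗.conv_assoc a b g,
      fun a b => (𝓗.conv_assoc a g b).symm⟩
  · suffices ∃ g, ∀ a : 𝓗.fourier, 𝓗.conv g a = m.1 a ∧ 𝓗.conv a g = m.2 a by
      obtain ⟨g, hg⟩ := this
      exact ⟨g, Prod.ext (ContinuousLinearMap.ext fun a => Subtype.ext (hg a).1)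
        (ContinuousLinearMap.ext fun a => Subtype.ext (hg a).2)⟩
    by_cases hne : 𝓗.fourier = ⊥
    · -- on the zero space all operators agree
      refine ⟨0, fun a => ?_⟩
      have h0 : ∀ b : 𝓗.fourier, (b : S →L[ℂ] ℂ) = 0 := fun b =>
        (Submodule.mem_bot ℂ).1 (hne.le b.2)
      rw [h0 a, h0 (m.1 a), h0 (m.2 a), map_zero]
      exact ⟨rfl, rfl⟩
    · exact hsat.exists_eq_conv_of_mem_multipliers hne 𝓗.isInvariant_fourier h.1
        (h.2 _ (𝓗.isHopfIdeal_fourier hne)) hm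

theorem coe_toLeftMultiplier (h : S →L[ℂ] ℂ) (a : 𝓗.leftFourier) :
    (𝓗.toLeftMultiplier h a : S →L[ℂ] ℂ) = 𝓗.conv h a := rfl

theorem IsSaturated.injective_toLeftMultiplier (hsat : 𝓗.IsSaturated)
    (hne : 𝓗.leftFourier ≠ ⊥) : Function.Injective 𝓗.toLeftMultiplier := fun g k hgk => by
  rw [← sub_eq_zero]
  refine hsat.eq_zero_of_conv_left hne 𝓗.isInvariant_leftFourier fun a ha => ?_
  rw [map_sub, sub_apply, sub_eq_zero]
  rw [← coe_toLeftMultiplier g ⟨a, ha⟩, ← coe_toLeftMultiplier k ⟨a, ha⟩, hgk]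

theorem coe_toRightMultiplier (h : S →L[ℂ] ℂ) (a : 𝓗.rightFourier) :
    (𝓗.toRightMultiplier h a : S →L[ℂ] ℂ) = 𝓗.conv a h := rfl

theorem IsSaturated.injective_toRightMultiplier (hsat : 𝓗.IsSaturated)
    (hne : 𝓗.rightFourier ≠ ⊥) : Function.Injective 𝓗.toRightMultiplier := fun g k hgk => by
  rw [← sub_eq_zero]
  refine hsat.eq_zero_of_conv_right hne 𝓗.isInvariant_rightFourier fun a ha => ?_
  rw [map_sub, sub_eq_zero]
  rw [← coe_toRightMultiplier g ⟨a, ha⟩, ← coe_toRightMultiplier k ⟨a, ha⟩, hgk]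

theorem coe_toMultiplier_fst (h : S →L[ℂ] ℂ) (a : 𝓗.fourier) :
    ((𝓗.toMultiplier h).1 a : S →L[ℂ] ℂ) = 𝓗.conv h a := rfl

theorem IsSaturated.injective_toMultiplier (hsat : 𝓗.IsSaturated)
    (hne : 𝓗.fourier ≠ ⊥) : Function.Injective 𝓗.toMultiplier := fun g k hgk => by
  rw [← sub_eq_zero]
  refine hsat.eq_zero_of_conv_left hne 𝓗.isInvariant_fourier fun a ha => ?_
  rw [map_sub, sub_apply, sub_eq_zero]
  rw [← coe_toMultiplier_fst g ⟨a, ha⟩, ← coe_toMultiplier_fst k ⟨a, ha⟩, hgk]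

end Fourier

end HopfCStarAlgebra

end HopfCStar

end

theorem theorem2p8 {S H : Type*} [NonUnitalCStarAlgebra S]
    [NormedAddCommGroup H] [InnerProductSpace ℂ H] [CompleteSpace H]
    (π : HopfCStar.FaithfulRep S H) (𝓗 : HopfCStar.HopfCStarAlgebra π)
    (hsat : 𝓗.IsSaturated) :
    ((𝓗.LeftH1 → 𝓗.LeftH2) ∧ (𝓗.RightH1 → 𝓗.RightH2) ∧ (𝓗.TwoSidedH1 → 𝓗.TwoSidedH2)) ∧
    (𝓗.TwoSidedH2 →
      𝓗.TwoSidedH3 ∧ (𝓗.fourier ≠ ⊥ → Function.Injective 𝓗.toMultiplier)) ∧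
    ((𝓗.LeftH1 → 𝓗.LeftH3 ∧ Function.Injective 𝓗.toLeftMultiplier) ∧
      (𝓗.RightH1 → 𝓗.RightH3 ∧ Function.Injective 𝓗.toRightMultiplier)) :=
  ⟨⟨fun h => h.leftH2 hsat, fun h => h.rightH2 hsat, fun h => h.twoSidedH2 hsat⟩,
    fun h => ⟨h.twoSidedH3 hsat, hsat.injective_toMultiplier⟩,
    fun h => ⟨h.leftH3, hsat.injective_toLeftMultiplier h.1⟩,
    fun h => ⟨h.rightH3, hsat.injective_toRightMultiplier h.1⟩⟩
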